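/- Let $G$ be a finite cyclic group of odd order, written additively. A sequence $S$ over $G$ is a finite unordered sequence of elements of $G$, repetition allowed; $|S|$ denotes its length and $\mathsf v_g(S)$ the multiplicity of $g \in G$ in $S$. The sequence $S$ is called zero-sum free if no nonempty subsequence of $S$ has sum $0$. If $S$ is a zero-sum free sequence over $G$ with $$|S| \ge \frac{6|G|+26}{20},$$ then $S$ contains an element $g \in G$ with multiplicity $$\mathsf v_g(S) \ge \frac{6|S|-|G|+1}{16}.$$ -/

import Mathlib

/-- The set `Σ(S)` of all sums `σ(T)` of subsequences `T` of `S` with `1 ≤ |T| ≤ |S|`.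
A (finite, unordered) sequence over `G` is a multiset, a subsequence is a sub-multiset. -/
def seqSubsums {G : Type*} [AddCommGroup G] (S : Multiset G) : Set G :=
  {g | ∃ T : Multiset G, T ≤ S ∧ 1 ≤ T.card ∧ T.sum = g}

/-- The sequence `S` is zero-sum free if `0 ∉ Σ(S)`. -/
def SeqZeroSumFree {G : Type*} [AddCommGroup G] (S : Multiset G) : Prop :=
  (0 : G) ∉ seqSubsums S

/-! Write Σ₀(T) for the set of all subset sums of T, the empty sum included. If every multiplicity
in S were smaller than claimed, all would be at most h = ⌊(6|S| - |G|)/16⌋. When |S| ≤ 6h, the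
sequence splits into h sets of at most six distinct elements, and each such zero-sum free set T has
|Σ₀(T)| ≥ 6|T| - 15. Zero-sum freeness makes 0 uniquely represented in Σ₀(U) + Σ₀(V), so by Kneser's
theorem |Σ₀| - 1 is superadditive under concatenation. Hence |Σ₀(S)| ≥ 6|S| + 1 - 16h > |G|, which
is absurd (`le_card_subseqSums`). Otherwise the length hypothesis leaves only |S| - 6h between 1 and
4, and splitting off one more set of that size again gives too many sums.

The substance is the bound for small sets: 15 sums for five elements, 21 for six. Let B = Σ₀(T) and
let r(y) count the u in B with u + y in B. Then |B| - r is symmetric and subadditive, and r(x) ≥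
|Σ₀(T \ {x})| for x in T. So every element of C = {0} ∪ T ∪ -T has many representations, and
elements of C + C and C + C + C still have some. Kneser's theorem, sharpened by the symmetry of C
and the odd order of G, makes these sumsets large; if B were small, the total of r would exceed its
value |B|². This needs T to generate a large enough subgroup, and a finite search settles the small
ones.

Four elements may have only nine sums, but only if they generate a group of order 9;
`ZeroSumFree.exists_ten_le_card` avoids this exception where it matters. -/

open scoped Pointwise

/-! ### Kneser's theorem, and sumsets in which 0 is uniquely represented -/

section Kneser

/-- `A` is a union of cosets of `H`. -/
def IsPeriodic {G : Type*} [AddCommGroup G] (A : Finset G) (H : AddSubgroup G) : Prop :=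
  ∀ h ∈ H, ∀ x ∈ A, h + x ∈ A

lemma IsPeriodic.add_mem_iff {G : Type*} [AddCommGroup G] {A : Finset G} {H : AddSubgroup G}
    (hA : IsPeriodic A H) {h x : G} (hh : h ∈ H) : x + h ∈ A ↔ x ∈ A := by
  constructor
  · intro hx
    have := hA (-h) (H.neg_mem hh) _ hx
    simpa using this
  · intro hx
    rw [add_comm]
    exact hA h hh x hx

variable {G : Type*} [AddCommGroup G] [Fintype G] [DecidableEq G]

lemma IsPeriodic.card_dvd {A : Finset G} {H : AddSubgroup G} (hA : IsPeriodic A H) :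
    Nat.card H ∣ A.card := by
  classical
  rw [Finset.card_eq_sum_card_image (fun x : G => (QuotientAddGroup.mk x : G ⧸ H)) A]
  refine Finset.dvd_sum fun c hc => ?_
  obtain ⟨x, hx, rfl⟩ := Finset.mem_image.1 hc
  have : (A.filter fun y : G => (QuotientAddGroup.mk y : G ⧸ H) = QuotientAddGroup.mk x)
      = (Finset.univ.filter (· ∈ H)).image (x + ·) := by
    ext y
    simp only [Finset.mem_filter, Finset.mem_image, Finset.mem_univ, true_and]
    constructor
    · rintro ⟨hy, hxy⟩
      exact ⟨-x + y, QuotientAddGroup.eq.1 hxy.symm, by simp⟩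
    · rintro ⟨h, hh, rfl⟩
      exact ⟨(hA.add_mem_iff hh).2 hx, (QuotientAddGroup.eq.2 (by simpa using hh)).symm⟩
  rw [this, Finset.card_image_of_injective _ (add_right_injective x), Nat.card_eq_fintype_card,
    Fintype.card_subtype]

/-- Two pairs with equal sum `z + p + q` differ in the first coordinate by an element of `H ⊓ K`,
which bounds the fibres of this map on `P × Q`. -/
lemma card_mul_card_le_of_periodic {H K : AddSubgroup G} (P Q U : Finset G) (z : G)
    (hP : ∀ p ∈ P, p ∈ H) (hQ : ∀ q ∈ Q, q ∈ K) (hU : ∀ p ∈ P, ∀ q ∈ Q, z + p + q ∈ U) :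
    P.card * Q.card ≤ Nat.card (H ⊓ K : AddSubgroup G) * U.card := by
  classical
  rw [← Finset.card_product]
  refine (Finset.card_le_mul_card_image (f := fun x : G × G => z + x.1 + x.2) _
    (Nat.card (H ⊓ K : AddSubgroup G)) ?_).trans (Nat.mul_le_mul_left _ (Finset.card_le_card ?_))
  · intro u hu
    obtain ⟨⟨p, q⟩, hpq, rfl⟩ := Finset.mem_image.1 hu
    rw [Finset.mem_product] at hpq
    rw [Nat.card_eq_fintype_card, Fintype.card_subtype]
    refine Finset.card_le_card_of_injOn (fun x => x.1 - p) ?_ ?_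
    · rintro ⟨p', q'⟩ h
      simp only [Finset.coe_filter, Set.mem_ofPred_eq, Finset.mem_product, Finset.mem_univ,
        true_and, AddSubgroup.mem_inf] at h ⊢
      refine ⟨H.sub_mem (hP _ h.1.1) (hP _ hpq.1), ?_⟩
      have : p' - p = q - q' := by
        have h2 := h.2
        rw [add_assoc, add_assoc, add_right_inj] at h2
        rw [sub_eq_sub_iff_add_eq_add, h2, add_comm]
      rw [this]
      exact K.sub_mem (hQ _ hpq.2) (hQ _ h.1.2)
    · rintro ⟨p₁, q₁⟩ h₁ ⟨p₂, q₂⟩ h₂ h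
      simp only [Finset.coe_filter, Set.mem_ofPred_eq, sub_left_inj] at h₁ h₂ h
      subst h
      have := h₁.2.trans h₂.2.symm
      simp only [add_right_inj] at this
      rw [this]
  · intro u hu
    obtain ⟨⟨p, q⟩, hpq, rfl⟩ := Finset.mem_image.1 hu
    rw [Finset.mem_product] at hpq
    exact hU _ hpq.1 _ hpq.2

/-- The local counting step in the proof of Kneser's lemma on unions of periodic sets. -/
lemma periodic_union_aux {A B : Finset G} {H K : AddSubgroup G} (hA : IsPeriodic A H)
    (hB : IsPeriodic B K) {z : G} (hzB : z ∈ B) (hzA : z ∉ A) :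
    Nat.card H ≤ (B \ A).card + Nat.card (H ⊓ K : AddSubgroup G) ∨
    Nat.card K ≤ (A \ B).card + Nat.card (H ⊓ K : AddSubgroup G) ∨
    Nat.card K ≤ (B \ A).card := by
  classical
  set k := Nat.card (H ⊓ K : AddSubgroup G) with hk
  have hkpos : 0 < k := Nat.card_pos
  set Hf : Finset G := Finset.univ.filter (· ∈ H)
  set Kf : Finset G := Finset.univ.filter (· ∈ K)
  have hHf : Hf.card = Nat.card H := by
    rw [Nat.card_eq_fintype_card, Fintype.card_subtype]
  have hKf : Kf.card = Nat.card K := by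
    rw [Nat.card_eq_fintype_card, Fintype.card_subtype]
  set P : Finset G := Hf.filter fun p => z + p ∈ B with hPdef
  set Q : Finset G := Kf.filter fun q => z + q ∈ A with hQdef
  set P' : Finset G := Hf.filter fun p => ¬ z + p ∈ B with hPdef'
  set Q' : Finset G := Kf.filter fun q => ¬ z + q ∈ A with hQdef'
  have hPP : P.card + P'.card = Nat.card H := by
    rw [← hHf]; exact Finset.card_filter_add_card_filter_not _
  have hQQ : Q.card + Q'.card = Nat.card K := by
    rw [← hKf]; exact Finset.card_filter_add_card_filter_not _
  have hPmem : ∀ p ∈ P, p ∈ H ∧ z + p ∈ B := by intro p hp; simpa [P, Hf] using hp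
  have hQmem : ∀ p ∈ Q, p ∈ K ∧ z + p ∈ A := by intro p hp; simpa [Q, Kf] using hp
  have hPmem' : ∀ p ∈ P', p ∈ H ∧ z + p ∉ B := by intro p hp; simpa [P', Hf] using hp
  have hQmem' : ∀ p ∈ Q', p ∈ K ∧ z + p ∉ A := by intro p hp; simpa [Q', Kf] using hp
  have h1 : P.card * Q'.card ≤ k * (B \ A).card := by
    refine card_mul_card_le_of_periodic (H := H) (K := K) P Q' _ z (fun p hp => (hPmem p hp).1)
      (fun q hq => (hQmem' q hq).1) fun p hp q hq => ?_
    rw [Finset.mem_sdiff]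
    refine ⟨(hB.add_mem_iff (hQmem' q hq).1).2 (hPmem p hp).2, ?_⟩
    rw [add_right_comm, hA.add_mem_iff (hPmem p hp).1]
    exact (hQmem' q hq).2
  have h2 : P'.card * Q.card ≤ k * (A \ B).card := by
    refine card_mul_card_le_of_periodic (H := H) (K := K) P' Q _ z (fun p hp => (hPmem' p hp).1)
      (fun q hq => (hQmem q hq).1) fun p hp q hq => ?_
    rw [Finset.mem_sdiff]
    refine ⟨?_, ?_⟩
    · rw [add_right_comm, hA.add_mem_iff (hPmem' p hp).1]
      exact (hQmem q hq).2
    · rw [hB.add_mem_iff (hQmem q hq).1]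
      exact (hPmem' p hp).2
  have hPper : k ∣ P.card := by
    refine IsPeriodic.card_dvd (H := H ⊓ K) fun h hh x hx => ?_
    obtain ⟨hx1, hx2⟩ := hPmem x hx
    simp only [P, Hf, Finset.mem_filter, Finset.mem_univ, true_and]
    refine ⟨H.add_mem hh.1 hx1, ?_⟩
    rw [add_comm h, ← add_assoc, hB.add_mem_iff hh.2]
    exact hx2
  have hQper : k ∣ Q.card := by
    refine IsPeriodic.card_dvd (H := H ⊓ K) fun h hh x hx => ?_
    obtain ⟨hx1, hx2⟩ := hQmem x hx
    simp only [Q, Kf, Finset.mem_filter, Finset.mem_univ, true_and]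
    refine ⟨K.add_mem hh.2 hx1, ?_⟩
    rw [add_comm h, ← add_assoc, hA.add_mem_iff hh.1]
    exact hx2
  have hkH : k ∣ Nat.card H := AddSubgroup.card_dvd_of_le inf_le_left
  have hkK : k ∣ Nat.card K := AddSubgroup.card_dvd_of_le inf_le_right
  have hP0 : 0 < P.card := Finset.card_pos.2 ⟨0, by simp [P, Hf, hzB]⟩
  have hQ0 : 0 < Q'.card := Finset.card_pos.2 ⟨0, by simp [Q', Kf, hzA]⟩
  have hPper' : k ∣ P'.card := (Nat.dvd_add_right hPper).1 (hPP ▸ hkH)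
  have hQper' : k ∣ Q'.card := (Nat.dvd_add_right hQper).1 (hQQ ▸ hkK)
  obtain ⟨p, hp⟩ := hPper
  obtain ⟨q, hq⟩ := hQper
  obtain ⟨p', hp'⟩ := hPper'
  obtain ⟨q', hq'⟩ := hQper'
  rw [← hPP, ← hQQ]
  rw [hp, hq'] at h1
  rw [hp', hq] at h2
  rw [hp, hp', hq, hq']
  have h1' : k * (p * q') ≤ (B \ A).card :=
    Nat.le_of_mul_le_mul_left (by linarith) hkpos
  have h2' : k * (p' * q) ≤ (A \ B).card :=
    Nat.le_of_mul_le_mul_left (by linarith) hkpos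
  have hp0 : 1 ≤ p := by by_contra h; simp_all
  have hq0 : 1 ≤ q' := by by_contra h; simp_all
  rcases Nat.eq_zero_or_pos q with hq1 | hq1
  · right; right
    subst hq1
    calc k * 0 + k * q' = k * (1 * q') := by ring
      _ ≤ k * (p * q') := by gcongr
      _ ≤ _ := h1'
  rcases Nat.eq_zero_or_pos p' with hp1 | hp1
  · left
    subst hp1
    calc k * p + k * 0 = k * (p * 1) := by ring
      _ ≤ k * (p * q') := by gcongr
      _ ≤ _ := h1'.trans (Nat.le_add_right _ _)
  -- From `(a - 1)(b - 1) ≥ 0`, applied to `p, q'` and to `p', q`; adding the two inequalities shows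
  -- that one of the alternatives holds.
  have key : p + p' ≤ p * q' + 1 ∨ q + q' ≤ p' * q + 1 := by
    have aux : ∀ a b : ℕ, 1 ≤ a → 1 ≤ b → a + b ≤ a * b + 1 := by
      intro a b ha hb
      obtain ⟨c, rfl⟩ := Nat.exists_eq_add_of_le' ha
      obtain ⟨d, rfl⟩ := Nat.exists_eq_add_of_le' hb
      ring_nf
      omega
    have := aux p q' hp0 hq0
    have := aux p' q hp1 hq1
    omega
  rcases key with h | h
  · left
    calc k * p + k * p' = k * (p + p') := by ring
      _ ≤ k * (p * q' + 1) := by gcongr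
      _ = k * (p * q') + k := by ring
      _ ≤ _ := by gcongr
  · right; left
    calc k * q + k * q' = k * (q + q') := by ring
      _ ≤ k * (p' * q + 1) := by gcongr
      _ = k * (p' * q) + k := by ring
      _ ≤ _ := by gcongr

/-- Kneser's lemma on unions of periodic sets. -/
lemma exists_periodic_union {A B : Finset G} {H K : AddSubgroup G} (hA : IsPeriodic A H)
    (hB : IsPeriodic B K) {s : ℕ} (hsA : s ≤ A.card + Nat.card H) (hsB : s ≤ B.card + Nat.card K) :
    ∃ L : AddSubgroup G, IsPeriodic (A ∪ B) L ∧ s ≤ (A ∪ B).card + Nat.card L := by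
  by_cases h1 : B ⊆ A
  · exact ⟨H, by rwa [Finset.union_eq_left.2 h1], by rwa [Finset.union_eq_left.2 h1]⟩
  by_cases h2 : A ⊆ B
  · exact ⟨K, by rwa [Finset.union_eq_right.2 h2], by rwa [Finset.union_eq_right.2 h2]⟩
  obtain ⟨z, hzB, hzA⟩ := Finset.not_subset.1 h1
  obtain ⟨w, hwA, hwB⟩ := Finset.not_subset.1 h2
  refine ⟨H ⊓ K, ?_, ?_⟩
  · intro h hh x hx
    rcases Finset.mem_union.1 hx with hx | hx
    · exact Finset.mem_union_left _ (hA h hh.1 x hx)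
    · exact Finset.mem_union_right _ (hB h hh.2 x hx)
  have e1 := periodic_union_aux hA hB hzB hzA
  have e2 := periodic_union_aux hB hA hwA hwB
  rw [inf_comm K H] at e2
  have c1 : (A ∪ B).card = A.card + (B \ A).card := by
    rw [← Finset.union_sdiff_self_eq_union, Finset.card_union_of_disjoint Finset.disjoint_sdiff]
  have c2 : (A ∪ B).card = B.card + (A \ B).card := by
    rw [Finset.union_comm, ← Finset.union_sdiff_self_eq_union,
      Finset.card_union_of_disjoint Finset.disjoint_sdiff]
  omega

/-- For `0 ∈ A ∩ B`, iterated Dyson transforms yield a periodic subset of `A + B` through `0`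
that satisfies the bound in Kneser's theorem. -/
lemma exists_periodic_subset_of_zero_mem (n : ℕ) : ∀ A B : Finset G, B.card = n → 0 ∈ A → 0 ∈ B →
    ∃ C ⊆ A + B, 0 ∈ C ∧ ∃ H : AddSubgroup G, IsPeriodic C H ∧
      A.card + B.card ≤ C.card + Nat.card H := by
  induction n using Nat.strong_induction_on with
  | _ n ih =>
  intro A B hn hA hB
  -- If translation by each element of `B` preserves `A`, then `A` is periodic under the subgroup
  -- generated by `B`. Otherwise the Dyson transform at some `e ∈ A` strictly shrinks `B`, keeps
  -- `|A| + |B|` and stays inside `A + B`.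
  by_cases h : ∀ e ∈ A, ∀ b ∈ B, b + e ∈ A
  · refine ⟨A, fun a ha => Finset.mem_add.2 ⟨a, ha, 0, hB, add_zero a⟩, hA,
      AddSubgroup.closure (B : Set G), ?_, ?_⟩
    · intro h' hh
      induction hh using AddSubgroup.closure_induction with
      | mem b hb => exact fun x hx => h x hx b hb
      | zero => simp
      | add y z _ _ hy hz => intro x hx; rw [add_assoc]; exact hy _ (hz _ hx)
      | neg y _ hy =>
        intro x hx
        have hinj : A.image (y + ·) = A :=
          Finset.eq_of_subset_of_card_le (Finset.image_subset_iff.2 hy)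
            (Finset.card_image_of_injective _ (add_right_injective y)).ge
        rw [← hinj] at hx
        obtain ⟨x', hx', rfl⟩ := Finset.mem_image.1 hx
        simpa using hx'
    · gcongr
      classical
      rw [Nat.card_eq_fintype_card, Fintype.card_subtype]
      exact Finset.card_le_card fun b hb => by simpa using AddSubgroup.subset_closure hb
  · push Not at h
    obtain ⟨e, he, b, hb, hbe⟩ := h
    set A' := A ∪ B.image (· + e) with hA'
    set B' := B.filter (fun b => b + e ∈ A) with hB'
    have hcard : A'.card + B'.card = A.card + B.card := by
      have h3 : (A ∩ B.image (· + e)).card = B'.card := by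
        rw [← Finset.card_image_of_injective B' (add_left_injective e)]
        congr 1
        ext x
        simp only [hB', Finset.mem_inter, Finset.mem_image, Finset.mem_filter]
        aesop
      rw [← h3, hA', Finset.card_union_add_card_inter,
        Finset.card_image_of_injective _ (add_left_injective e)]
    have hlt : B'.card < n := by
      rw [← hn]
      refine Finset.card_lt_card (Finset.filter_ssubset.2 ⟨b, hb, hbe⟩)
    obtain ⟨C, hC, hC0, H, hH, hle⟩ := ih _ hlt A' B' rfl (Finset.mem_union_left _ hA)
      (by simp [hB', hB, he])
    refine ⟨C, hC.trans ?_, hC0, H, hH, hcard ▸ hle⟩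
    intro x hx
    obtain ⟨a', ha', b', hb', rfl⟩ := Finset.mem_add.1 hx
    rw [hB', Finset.mem_filter] at hb'
    rcases Finset.mem_union.1 ha' with ha' | ha'
    · exact Finset.add_mem_add ha' hb'.1
    · obtain ⟨b'', hb'', rfl⟩ := Finset.mem_image.1 ha'
      rw [add_comm b'', add_right_comm, add_comm e]
      exact Finset.add_mem_add hb'.2 hb''

lemma exists_periodic_subset {A B : Finset G} {a b : G} (ha : a ∈ A) (hb : b ∈ B) :
    ∃ C ⊆ A + B, a + b ∈ C ∧ ∃ H : AddSubgroup G, IsPeriodic C H ∧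
      A.card + B.card ≤ C.card + Nat.card H := by
  obtain ⟨C, hC, hC0, H, hH, hle⟩ := exists_periodic_subset_of_zero_mem _
    (A.image (-a + ·)) (B.image (-b + ·)) rfl (Finset.mem_image.2 ⟨a, ha, by simp⟩)
    (Finset.mem_image.2 ⟨b, hb, by simp⟩)
  rw [Finset.card_image_of_injective _ (add_right_injective _),
    Finset.card_image_of_injective _ (add_right_injective _)] at hle
  refine ⟨C.image (a + b + ·), ?_, Finset.mem_image.2 ⟨0, hC0, by simp⟩, H, ?_, ?_⟩
  · intro x hx
    obtain ⟨c, hc, rfl⟩ := Finset.mem_image.1 hx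
    obtain ⟨a', ha', b', hb', rfl⟩ := Finset.mem_add.1 (hC hc)
    obtain ⟨a'', ha'', rfl⟩ := Finset.mem_image.1 ha'
    obtain ⟨b'', hb'', rfl⟩ := Finset.mem_image.1 hb'
    exact Finset.mem_add.2 ⟨a'', ha'', b'', hb'', by abel⟩
  · intro h hh x hx
    obtain ⟨c, hc, rfl⟩ := Finset.mem_image.1 hx
    exact Finset.mem_image.2 ⟨h + c, hH h hh c hc, by abel⟩
  · rwa [Finset.card_image_of_injective _ (add_right_injective _)]

/-- Each pair (a, b) yields a periodic subset of `A + B` through a + b that meets the bound. Their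
union is `A + B`, and `exists_periodic_union` preserves the bound. -/
lemma exists_periodic_card_le {A B : Finset G} (hA : A.Nonempty) (hB : B.Nonempty) :
    ∃ H : AddSubgroup G, IsPeriodic (A + B) H ∧ A.card + B.card ≤ (A + B).card + Nat.card H := by
  have main : ∀ T : Finset (G × G), T.Nonempty → T ⊆ A ×ˢ B → ∃ D ⊆ A + B,
      (∀ x ∈ T, x.1 + x.2 ∈ D) ∧ ∃ H : AddSubgroup G, IsPeriodic D H ∧
        A.card + B.card ≤ D.card + Nat.card H := by
    intro T hT
    induction hT using Finset.Nonempty.cons_induction with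
    | singleton x =>
      intro hx
      rw [Finset.singleton_subset_iff, Finset.mem_product] at hx
      obtain ⟨C, hC, hab, h⟩ := exists_periodic_subset hx.1 hx.2
      exact ⟨C, hC, by simpa using hab, h⟩
    | cons x T hx _ ih =>
      intro hT
      rw [Finset.cons_subset, Finset.mem_product] at hT
      obtain ⟨C, hC, hab, H, hH, hle⟩ := exists_periodic_subset hT.1.1 hT.1.2
      obtain ⟨D, hD, hT', K, hK, hle'⟩ := ih hT.2
      refine ⟨C ∪ D, Finset.union_subset hC hD, ?_, exists_periodic_union hH hK hle hle'⟩
      intro y hy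
      rcases Finset.mem_cons.1 hy with rfl | hy
      · exact Finset.mem_union_left _ hab
      · exact Finset.mem_union_right _ (hT' y hy)
  obtain ⟨D, hD, hT, H, hH, hle⟩ := main (A ×ˢ B) (hA.product hB) subset_rfl
  have : D = A + B := by
    refine hD.antisymm fun x hx => ?_
    obtain ⟨a, ha, b, hb, rfl⟩ := Finset.mem_add.1 hx
    exact hT (a, b) (Finset.mk_mem_product ha hb)
  subst this
  exact ⟨H, hH, hle⟩

/-- The union of the cosets of `H` that meet `A`. -/
noncomputable def cosetHull (A : Finset G) (H : AddSubgroup G) : Finset G :=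
  open Classical in A + Finset.univ.filter (· ∈ H)

lemma mem_cosetHull {A : Finset G} {H : AddSubgroup G} {x : G} :
    x ∈ cosetHull A H ↔ ∃ a ∈ A, ∃ h ∈ H, a + h = x := by
  simp [cosetHull, Finset.mem_add]

lemma subset_cosetHull (A : Finset G) (H : AddSubgroup G) : A ⊆ cosetHull A H :=
  fun a ha => mem_cosetHull.2 ⟨a, ha, 0, H.zero_mem, add_zero a⟩

lemma isPeriodic_cosetHull (A : Finset G) (H : AddSubgroup G) : IsPeriodic (cosetHull A H) H := by
  intro h hh x hx
  obtain ⟨a, ha, k, hk, rfl⟩ := mem_cosetHull.1 hx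
  exact mem_cosetHull.2 ⟨a, ha, h + k, H.add_mem hh hk, by abel⟩

/-- **Kneser's theorem**. -/
theorem kneser {A B : Finset G} (hA : A.Nonempty) (hB : B.Nonempty) :
    ∃ H : AddSubgroup G, IsPeriodic (A + B) H ∧
      (cosetHull A H).card + (cosetHull B H).card ≤ (A + B).card + Nat.card H := by
  -- `H` is the full stabilizer of `A + B`. Coset hulls have the same sumset, so the weak form
  -- applied to them gives a period contained in `H`.
  let H : AddSubgroup G :=
    { carrier := {h | ∀ x, h + x ∈ A + B ↔ x ∈ A + B}
      zero_mem' := by simp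
      add_mem' := by
        intro h k hh hk x
        rw [add_assoc, hh, hk]
      neg_mem' := by
        intro h hh x
        rw [← hh (-h + x)]
        simp }
  have hH : IsPeriodic (A + B) H := fun h hh x hx => (hh x).2 hx
  refine ⟨H, hH, ?_⟩
  have hsum : cosetHull A H + cosetHull B H = A + B := by
    refine subset_antisymm ?_ (Finset.add_subset_add (subset_cosetHull A H) (subset_cosetHull B H))
    intro x hx
    obtain ⟨y, hy, z, hz, rfl⟩ := Finset.mem_add.1 hx
    obtain ⟨a, ha, h, hh, rfl⟩ := mem_cosetHull.1 hy
    obtain ⟨b, hb, k, hk, rfl⟩ := mem_cosetHull.1 hz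
    have := hH (h + k) (H.add_mem hh hk) (a + b) (Finset.add_mem_add ha hb)
    convert this using 1
    abel
  obtain ⟨K, hK, hle⟩ := exists_periodic_card_le (hA.mono (subset_cosetHull A H))
    (hB.mono (subset_cosetHull B H))
  rw [hsum] at hK hle
  have hKH : K ≤ H := fun k hk x => ⟨fun hx => by
    have := hK (-k) (K.neg_mem hk) _ hx
    simpa using this, fun hx => hK k hk x hx⟩
  exact hle.trans (by gcongr; exact AddSubgroup.card_le_of_le hKH)

/-- If `0` is represented only trivially in `A + B` then `|A + B| ≥ |A| + |B| - 1`. -/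
theorem card_add_card_le_of_unique_zero {A B : Finset G} (hA : 0 ∈ A) (hB : 0 ∈ B)
    (h : ∀ a ∈ A, ∀ b ∈ B, a + b = 0 → b = 0) : A.card + B.card ≤ (A + B).card + 1 := by
  classical
  obtain ⟨H, hH, hle⟩ := kneser ⟨0, hA⟩ ⟨0, hB⟩
  set Hf : Finset G := Finset.univ.filter (· ∈ H)
  have hHf : Hf.card = Nat.card H := by
    rw [Nat.card_eq_fintype_card, Fintype.card_subtype]
  have key : ∀ X : Finset G, 0 ∈ X → X.card + Hf.card ≤ (cosetHull X H).card + (X ∩ Hf).card := by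
    intro X hX
    rw [← Finset.card_union_add_card_inter]
    gcongr
    refine Finset.union_subset (subset_cosetHull _ _) fun x hx => ?_
    exact mem_cosetHull.2 ⟨0, hX, x, by simpa [Hf] using hx, zero_add x⟩
  have h1 := key A hA
  have h2 := key B hB
  -- Inside `H`, the sets `A` and `-B` meet only in 0.
  have h3 : (A ∩ Hf).card + (B ∩ Hf).card ≤ Hf.card + 1 := by
    rw [← Finset.card_image_of_injective (B ∩ Hf) neg_injective,
      ← Finset.card_union_add_card_inter]
    gcongr
    · refine Finset.union_subset Finset.inter_subset_right ?_
      intro x hx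
      simp only [Finset.mem_image, Finset.mem_inter] at hx
      obtain ⟨y, hy, rfl⟩ := hx
      have : y ∈ H := by simpa [Hf] using hy.2
      simpa [Hf] using this
    · rw [← Finset.card_singleton (0 : G)]
      refine Finset.card_le_card fun x hx => ?_
      simp only [Finset.mem_image, Finset.mem_inter] at hx
      obtain ⟨hx, y, hy, rfl⟩ := hx
      rw [h _ hx.1 y hy.1 (by simp)]
      simp
  omega

end Kneser

/-! ### Counting representations as differences -/

section Representations

variable {G : Type*} [AddCommGroup G] [DecidableEq G]

/-- The number of representations of `y` as a difference of two elements of `B`. -/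
def diffRep (B : Finset G) (y : G) : ℕ := (B.filter fun u => u + y ∈ B).card

lemma diffRep_le (B : Finset G) (y : G) : diffRep B y ≤ B.card := Finset.card_filter_le _ _

lemma diffRep_zero (B : Finset G) : diffRep B 0 = B.card := by simp [diffRep]

lemma diffRep_neg (B : Finset G) (y : G) : diffRep B (-y) = diffRep B y := by
  refine Finset.card_bij' (fun u _ => u + -y) (fun u _ => u + y) ?_ ?_ ?_ ?_ <;> simp <;> tauto

/-- The defect `B.card - diffRep B y` counts the `u ∈ B` that leave `B` under translation by `y`;
this says that the defect is subadditive. -/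
lemma diffRep_add (B : Finset G) (x y : G) :
    diffRep B x + diffRep B y ≤ B.card + diffRep B (x + y) := by
  have h1 : diffRep B y = ((B.filter fun u => u + x ∈ B ∧ u + x + y ∈ B) ∪
      ((B.image (· - x)).filter fun u => u ∉ B ∧ u + x + y ∈ B)).card := by
    rw [diffRep, ← Finset.card_image_of_injective _ (sub_left_injective (b := x))]
    congr 1
    ext u
    simp only [Finset.mem_image, Finset.mem_filter, Finset.mem_union]
    constructor
    · rintro ⟨a, ⟨ha, hay⟩, rfl⟩
      by_cases h : a - x ∈ B
      · left; simp [h, ha, hay]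
      · right; simp [h, ha, hay]
    · rintro (⟨h1, h2, h3⟩ | ⟨⟨a, ha, rfl⟩, h2, h3⟩)
      · exact ⟨u + x, ⟨h2, h3⟩, by simp⟩
      · exact ⟨a, ⟨ha, by simpa using h3⟩, rfl⟩
  have h2 : (B.filter fun u => u + x ∈ B ∧ u + x + y ∈ B).card ≤ diffRep B (x + y) := by
    refine Finset.card_le_card fun u hu => ?_
    simp only [Finset.mem_filter] at hu ⊢
    exact ⟨hu.1, by rw [← add_assoc]; exact hu.2.2⟩
  have h3 : diffRep B x + ((B.image (· - x)).filter fun u => u ∉ B ∧ u + x + y ∈ B).card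
      ≤ B.card := by
    rw [diffRep, ← Finset.card_image_of_injective B (sub_left_injective (b := x)),
      ← Finset.card_union_of_disjoint]
    · refine Finset.card_le_card (Finset.union_subset (fun u hu => ?_) (Finset.filter_subset _ _))
      simp only [Finset.mem_filter] at hu
      exact Finset.mem_image.2 ⟨u + x, hu.2, by simp⟩
    · rw [Finset.disjoint_left]
      intro u hu hu'
      simp only [Finset.mem_filter] at hu hu'
      exact hu'.2.1 hu.1
  have h4 := Finset.card_union_le (B.filter fun u => u + x ∈ B ∧ u + x + y ∈ B)
    ((B.image (· - x)).filter fun u => u ∉ B ∧ u + x + y ∈ B)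
  omega

/-- The set of elements with more than `t` representations. -/
def popular [Fintype G] (B : Finset G) (t : ℕ) : Finset G :=
  Finset.univ.filter fun y => t < diffRep B y

/-- Layer-cake summation of `diffRep B`, whose total counts all ordered pairs from `B`. Lower bounds
on popular sets contradict this identity when `B` is too small. -/
lemma sum_card_popular [Fintype G] (B : Finset G) :
    ∑ t ∈ Finset.range B.card, (popular B t).card = B.card ^ 2 := by
  have h1 : ∑ y, diffRep B y = B.card ^ 2 := by
    simp only [diffRep, Finset.card_filter]
    rw [Finset.sum_comm]
    simp only [← Finset.card_filter]
    rw [Finset.sum_congr rfl (g := fun _ => B.card), Finset.sum_const, smul_eq_mul, sq]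
    intro u _
    rw [← Finset.card_image_of_injective B (sub_left_injective (b := u))]
    congr 1
    ext y
    simp only [Finset.mem_filter, Finset.mem_univ, true_and, Finset.mem_image]
    exact ⟨fun h => ⟨_, h, by simp⟩, by rintro ⟨b, hb, rfl⟩; simpa using hb⟩
  rw [← h1]
  simp only [popular, Finset.card_filter]
  rw [Finset.sum_comm]
  refine Finset.sum_congr rfl fun y _ => ?_
  rw [← Finset.card_filter]
  have : (Finset.range B.card).filter (fun t => t < diffRep B y) = Finset.range (diffRep B y) := by
    ext t
    simp only [Finset.mem_filter, Finset.mem_range]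
    exact ⟨fun h => h.2, fun h => ⟨h.trans_le (diffRep_le B y), h⟩⟩
  rw [this, Finset.card_range]

lemma card_union_image_add (B : Finset G) (x : G) :
    (B ∪ B.image (x + ·)).card + diffRep B x = 2 * B.card := by
  have : diffRep B x = (B ∩ B.image (x + ·)).card := by
    rw [diffRep, ← Finset.card_image_of_injective _ (add_right_injective x)]
    congr 1
    ext u
    simp only [Finset.mem_image, Finset.mem_filter, Finset.mem_inter]
    constructor
    · rintro ⟨a, ⟨ha, hax⟩, rfl⟩
      exact ⟨by rwa [add_comm], a, ha, rfl⟩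
    · rintro ⟨hu, a, ha, rfl⟩
      exact ⟨a, ⟨ha, by rwa [add_comm]⟩, rfl⟩
  rw [this, Finset.card_union_add_card_inter,
    Finset.card_image_of_injective _ (add_right_injective x), two_mul]

end Representations

/-! ### Subset sums under insertion of an element -/

section SubsetSums

variable {G : Type*} [AddCommGroup G] [DecidableEq G]

lemma subsetSum_insert {S : Finset G} {x : G} (hx : x ∉ S) :
    (insert x S).subsetSum = S.subsetSum ∪ S.subsetSum.image (x + ·) := by
  ext y
  simp only [Finset.mem_union, Finset.mem_image, Finset.mem_subsetSum_iff]
  constructor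
  · rintro ⟨T, hT, rfl⟩
    by_cases h : x ∈ T
    · right
      exact ⟨_, ⟨T.erase x, Finset.subset_insert_iff.1 hT, rfl⟩,
        Finset.add_sum_erase _ (fun z => z) h⟩
    · left
      exact ⟨T, (Finset.subset_insert_iff_of_notMem h).1 hT, rfl⟩
  · rintro (⟨T, hT, rfl⟩ | ⟨_, ⟨T, hT, rfl⟩, rfl⟩)
    · exact ⟨T, hT.trans (Finset.subset_insert _ _), rfl⟩
    · exact ⟨insert x T, Finset.insert_subset_insert _ hT,
        Finset.sum_insert fun h => hx (hT h)⟩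

lemma card_subsetSum_insert {S : Finset G} {x : G} (hx : x ∉ S) :
    (insert x S).subsetSum.card + diffRep S.subsetSum x = 2 * S.subsetSum.card := by
  rw [subsetSum_insert hx, card_union_image_add]

lemma card_subsetSum_le_diffRep {S : Finset G} {x : G} (hx : x ∉ S) :
    S.subsetSum.card ≤ diffRep (insert x S).subsetSum x := by
  refine Finset.card_le_card fun u hu => ?_
  rw [Finset.mem_filter, subsetSum_insert hx]
  exact ⟨Finset.mem_union_left _ hu,
    Finset.mem_union_right _ (Finset.mem_image.2 ⟨u, hu, add_comm _ _⟩)⟩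

lemma subsetSum_subset_of_subset {S : Finset G} {H : AddSubgroup G} (h : ∀ x ∈ S, x ∈ H) :
    ∀ y ∈ S.subsetSum, y ∈ H := by
  intro y hy
  obtain ⟨T, hT, rfl⟩ := Finset.mem_subsetSum_iff.1 hy
  exact sum_mem fun x hx => h x (hT hx)

/-- A finite set without a nonempty subset of sum zero. -/
def ZeroSumFree (S : Finset G) : Prop := ∀ T ⊆ S, T.Nonempty → ∑ x ∈ T, x ≠ 0

omit [DecidableEq G] in
lemma ZeroSumFree.mono {S T : Finset G} (hS : ZeroSumFree S) (h : T ⊆ S) : ZeroSumFree T :=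
  fun U hU => hS U (hU.trans h)

omit [DecidableEq G] in
lemma ZeroSumFree.ne_zero {S : Finset G} (hS : ZeroSumFree S) {x : G} (hx : x ∈ S) : x ≠ 0 := by
  simpa using hS {x} (by simpa using hx) (by simp)

end SubsetSums

/-! ### Sumsets of symmetric sets in groups of odd order -/

section Symmetric

variable {G : Type*} [AddCommGroup G] [Fintype G]

omit [Fintype G] in
lemma eq_zero_of_add_self_eq_zero (hodd : Odd (Nat.card G)) {x : G} (h : x + x = 0) : x = 0 := by
  have h2 : addOrderOf x ∣ 2 := addOrderOf_dvd_of_nsmul_eq_zero (by rw [two_nsmul, h])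
  have h3 : addOrderOf x ∣ Nat.card G := addOrderOf_dvd_natCard x
  have h4 : addOrderOf x ∣ Nat.gcd (Nat.card G) 2 := Nat.dvd_gcd h3 h2
  rw [Nat.Coprime.gcd_eq_one (Nat.coprime_two_right.2 hodd), Nat.dvd_one] at h4
  exact AddMonoid.addOrderOf_eq_one_iff.1 h4

-- In odd order, negation fixes only 0, so it pairs off the remaining elements.
omit [Fintype G] in
lemma odd_card_of_symmetric [DecidableEq G] (hodd : Odd (Nat.card G)) {X : Finset G} (h0 : 0 ∈ X)
    (hX : ∀ x ∈ X, -x ∈ X) : Odd X.card := by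
  have : Even (X.erase 0).card := by
    rw [← ZMod.natCast_eq_zero_iff_even, Finset.card_eq_sum_ones, Nat.cast_sum]
    refine Finset.sum_involution (fun x _ => -x) (fun x _ => by decide) (fun x hx _ h => ?_)
      (fun x hx => ?_) (fun x _ => neg_neg x)
    · refine (Finset.mem_erase.1 hx).1 (eq_zero_of_add_self_eq_zero hodd ?_)
      nth_rw 1 [← h]
      simp
    · rw [Finset.mem_erase] at hx ⊢
      exact ⟨neg_ne_zero.2 hx.1, hX x hx.2⟩
  rw [← Finset.card_erase_add_one h0]
  exact this.add_one

variable [DecidableEq G]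

/-- The hull of the symmetric set `C` is again symmetric, hence of odd size, so it consists of an
odd number `m` of cosets of the Kneser period. If `m = 1` then `C` lies in the period; otherwise `m
≥ 3`, which improves the bound. -/
lemma growth (hodd : Odd (Nat.card G)) {C D : Finset G} (hC0 : 0 ∈ C) (hC : ∀ x ∈ C, -x ∈ C)
    (hD0 : 0 ∈ D) :
    (∃ H : AddSubgroup G, (∀ x ∈ C, x ∈ H) ∧ Nat.card H ≤ (D + C).card) ∨
    ∃ H : AddSubgroup G, IsPeriodic (D + C) H ∧
      (cosetHull D H).card + (cosetHull C H).card ≤ (D + C).card + Nat.card H ∧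
      Odd (Nat.card H) ∧ ∃ m, Odd m ∧ 3 ≤ m ∧ (cosetHull C H).card = m * Nat.card H := by
  obtain ⟨H, hH, hle⟩ := kneser (A := D) (B := C) ⟨0, hD0⟩ ⟨0, hC0⟩
  have hsub := subset_cosetHull C H
  have hodd' : Odd (cosetHull C H).card := by
    refine odd_card_of_symmetric hodd (hsub hC0) fun x hx => ?_
    obtain ⟨a, ha, h, hh, rfl⟩ := mem_cosetHull.1 hx
    exact mem_cosetHull.2 ⟨-a, hC a ha, -h, H.neg_mem hh, by abel⟩
  obtain ⟨m, hm⟩ := (isPeriodic_cosetHull C H).card_dvd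
  rw [mul_comm] at hm
  have hoddH : Odd (Nat.card H) := hodd.of_dvd_nat (AddSubgroup.card_addSubgroup_dvd_card H)
  have hmodd : Odd m := by rw [hm, Nat.odd_mul] at hodd'; exact hodd'.1
  have h0 : (0 : G) ∈ D + C := Finset.mem_add.2 ⟨0, hD0, 0, hC0, add_zero 0⟩
  by_cases h3 : 3 ≤ m
  · exact Or.inr ⟨H, hH, hle, hoddH, m, hmodd, h3, hm⟩
  · have hm1 : m = 1 := by obtain ⟨k, rfl⟩ := hmodd; omega
    left
    refine ⟨H, ?_, Nat.le_of_dvd (Finset.card_pos.2 ⟨0, h0⟩) hH.card_dvd⟩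
    classical
    have hHf : (Finset.univ.filter (· ∈ H)).card = Nat.card H := by
      rw [Nat.card_eq_fintype_card, Fintype.card_subtype]
    have heq : Finset.univ.filter (· ∈ H) = cosetHull C H := by
      refine Finset.eq_of_subset_of_card_le (fun x hx => ?_) (by rw [hm, hm1, hHf, one_mul])
      exact mem_cosetHull.2 ⟨0, hC0, x, by simpa using hx, zero_add x⟩
    intro x hx
    have := hsub hx
    rw [← heq] at this
    simpa using this

/-- `S` together with `0` and the negatives of its elements. -/
def symHull (S : Finset G) : Finset G := insert 0 (S ∪ S.image (- ·))

omit [Fintype G] in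
lemma mem_symHull {S : Finset G} {x : G} : x ∈ symHull S ↔ x = 0 ∨ x ∈ S ∨ -x ∈ S := by
  simp only [symHull, Finset.mem_insert, Finset.mem_union, Finset.mem_image]
  constructor
  · rintro (h | h | ⟨a, ha, rfl⟩)
    · exact Or.inl h
    · exact Or.inr (Or.inl h)
    · exact Or.inr (Or.inr (by simpa using ha))
  · rintro (h | h | h)
    · exact Or.inl h
    · exact Or.inr (Or.inl h)
    · exact Or.inr (Or.inr ⟨-x, h, by simp⟩)

omit [Fintype G] in
lemma zero_mem_symHull (S : Finset G) : 0 ∈ symHull S := mem_symHull.2 (Or.inl rfl)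

omit [Fintype G] in
lemma neg_mem_symHull {S : Finset G} : ∀ x ∈ symHull S, -x ∈ symHull S := by
  intro x hx
  rw [mem_symHull] at hx ⊢
  simp only [neg_eq_zero, neg_neg]
  tauto

omit [Fintype G] in
lemma ZeroSumFree.neg_notMem_self {S : Finset G} (hS : ZeroSumFree S)
    (h2 : ∀ x : G, x + x = 0 → x = 0) {x : G} (hx : x ∈ S) : -x ∉ S := by
  intro h
  by_cases hxx : x = -x
  · exact hS.ne_zero hx (h2 x (by nth_rw 2 [hxx]; simp))
  · exact hS {x, -x} (by intro y; simp; rintro (rfl | rfl) <;> assumption) (by simp)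
      (by rw [Finset.sum_pair hxx, add_neg_cancel])

omit [Fintype G] in
lemma card_symHull (hodd : Odd (Nat.card G)) {S : Finset G} (hS : ZeroSumFree S) :
    (symHull S).card = 2 * S.card + 1 := by
  rw [symHull, Finset.card_insert_of_notMem, Finset.card_union_of_disjoint,
    Finset.card_image_of_injective _ neg_injective, two_mul]
  · rw [Finset.disjoint_left]
    intro x hx hx'
    obtain ⟨y, hy, rfl⟩ := Finset.mem_image.1 hx'
    exact hS.neg_notMem_self (fun _ => eq_zero_of_add_self_eq_zero hodd) hy hx
  · simp only [Finset.mem_union, Finset.mem_image, neg_eq_zero, exists_eq_right, or_self]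
    exact fun h => hS.ne_zero h rfl

omit [Fintype G] in
lemma closure_le_of_symHull {S : Finset G} {H : AddSubgroup G} (h : ∀ x ∈ symHull S, x ∈ H) :
    AddSubgroup.closure (S : Set G) ≤ H :=
  (AddSubgroup.closure_le H).2 fun x hx => h x (mem_symHull.2 (Or.inr (Or.inl hx)))

lemma card_double_symHull (hodd : Odd (Nat.card G)) (S : Finset G) :
    Nat.card (AddSubgroup.closure (S : Set G)) ≤ (symHull S + symHull S).card ∨
    ∃ H : AddSubgroup G, IsPeriodic (symHull S + symHull S) H ∧
      2 * (cosetHull (symHull S) H).card ≤ (symHull S + symHull S).card + Nat.card H ∧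
      Odd (Nat.card H) ∧ ∃ m, Odd m ∧ 3 ≤ m ∧ (cosetHull (symHull S) H).card = m * Nat.card H := by
  rcases growth hodd (zero_mem_symHull S) neg_mem_symHull (zero_mem_symHull S) with
    ⟨H, hH, hle⟩ | ⟨H, h1, h2, h3⟩
  · exact Or.inl ((AddSubgroup.card_le_of_le (closure_le_of_symHull hH)).trans hle)
  · exact Or.inr ⟨H, h1, by omega, h3⟩

lemma odd_cases {h : ℕ} (hh : Odd h) : h = 1 ∨ h = 3 ∨ 5 ≤ h := by
  obtain ⟨k, rfl⟩ := hh; omega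

/-- With C = `symHull S`, Kneser gives at least (2m - 1)|H| elements, where m ≥ 3 is odd and m|H| ≥
|C|, and |C| is 9, 11 or 13. The values are 17, 21, 25 for |H| = 1, at least 15, 27, 27 for |H| = 3,
and at least 25 for |H| ≥ 5. -/
lemma card_double_symHull_ge (hodd : Odd (Nat.card G)) {S : Finset G} (hS : ZeroSumFree S) {n : ℕ}
    (hn : n ≤ Nat.card (AddSubgroup.closure (S : Set G)))
    (h : S.card = 4 ∧ n ≤ 15 ∨ S.card = 5 ∧ n ≤ 21 ∨ S.card = 6 ∧ n ≤ 25) :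
    n ≤ (symHull S + symHull S).card := by
  rcases card_double_symHull hodd S with h1 | ⟨H, -, h2, hoddH, m, hm, h3, h4⟩
  · exact hn.trans h1
  have hc := card_symHull hodd hS
  have hle := Finset.card_le_card (subset_cosetHull (symHull S) H)
  rw [h4] at h2 hle
  obtain ⟨k, rfl⟩ := hm
  rcases odd_cases hoddH with h5 | h5 | h5
  · rw [h5] at h2 hle; omega
  · rw [h5] at h2 hle; omega
  · have : 2 * ((2 * k + 1) * Nat.card H) = (4 * k + 1) * Nat.card H + Nat.card H := by ring
    have h6 : 5 * 5 ≤ (4 * k + 1) * Nat.card H := Nat.mul_le_mul (by omega) h5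
    omega

/-- Adding `symHull S` once more gains at least (m - 1)|H| over the double sumset: |C| - 1 when |H|
= 1, at least 6, 12, 12 when |H| = 3, and at least 10 when |H| ≥ 5. -/
lemma card_triple_symHull_ge (hodd : Odd (Nat.card G)) {S : Finset G} (hS : ZeroSumFree S) {n : ℕ}
    (hn : n ≤ Nat.card (AddSubgroup.closure (S : Set G)))
    (h : S.card = 4 ∧ n ≤ 21 ∨ S.card = 5 ∧ n ≤ 31 ∨ S.card = 6 ∧ n ≤ 31) :
    n ≤ (symHull S + symHull S + symHull S).card := by
  have h0 : (0 : G) ∈ symHull S + symHull S :=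
    Finset.mem_add.2 ⟨0, zero_mem_symHull S, 0, zero_mem_symHull S, add_zero 0⟩
  rcases growth hodd (zero_mem_symHull S) neg_mem_symHull h0 with
    ⟨H, hH, hle⟩ | ⟨H, -, h2, hoddH, m, hm, h3, h4⟩
  · exact hn.trans ((AddSubgroup.card_le_of_le (closure_le_of_symHull hH)).trans hle)
  have hc := card_symHull hodd hS
  have hle := Finset.card_le_card (subset_cosetHull (symHull S) H)
  have hle2 := Finset.card_le_card (subset_cosetHull (symHull S + symHull S) H)
  have hd := card_double_symHull_ge hodd hS
    (n := min n (if S.card = 4 then 15 else if S.card = 5 then 21 else 25))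
    ((min_le_left _ _).trans hn) (by
      rcases h with h | h | h <;> simp [h.1])
  rw [h4] at h2 hle
  obtain ⟨k, rfl⟩ := hm
  have h6 : (2 * k + 1) * Nat.card H = 2 * k * Nat.card H + Nat.card H := by ring
  rcases odd_cases hoddH with h5 | h5 | h5
  · rw [h5] at h2 hle
    rcases h with h | h | h <;> simp [h.1] at hd <;> omega
  · rw [h5] at h2 hle
    rcases h with h | h | h <;> simp [h.1] at hd <;> omega
  · have h6 : 2 * 5 ≤ 2 * k * Nat.card H := Nat.mul_le_mul (by omega) h5
    rcases h with h | h | h <;> simp [h.1] at hd <;> omega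

end Symmetric

/-! ### Verified search in small cyclic groups -/

section Search

/-- The number of ones among the lowest `n` binary digits of `M`. -/
def bitCount (M : ℕ) : ℕ → ℕ
  | 0 => 0
  | n + 1 => (M >>> n) % 2 + bitCount M n

/-- Union of a subset of `ZMod N`, coded by the binary digits of `M`, with its translate by `x`. -/
def addTranslate (N M x : ℕ) : ℕ := (M ||| (M <<< x) ||| (M >>> (N - x))) % 2 ^ N

/-- `minSearch z N b x k M` checks that the subset of `ZMod N` coded by `M`, extended by all
subset sums of any `k` distinct elements of `{1, …, x}`, has at least `b` elements. If `z` is set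
then only elements are used whose negatives have not been reached before. -/
def minSearch (z : Bool) (N b : ℕ) : ℕ → ℕ → ℕ → Bool
  | 0, k, M => match k with
    | 0 => Nat.ble b (bitCount M N)
    | _ + 1 => true
  | x + 1, k, M => match k with
    | 0 => Nat.ble b (bitCount M N)
    | k + 1 => (bif z && Nat.ble 1 ((M >>> (N - (x + 1))) % 2) then true
        else minSearch z N b x k (addTranslate N M (x + 1))) && minSearch z N b x (k + 1) M

/-- The binary digits of `M` code the subset `A` of `ZMod N`. -/
def Codes (N M : ℕ) (A : Finset (ZMod N)) : Prop :=
  ∀ i, M.testBit i = true ↔ i < N ∧ (i : ZMod N) ∈ A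

lemma shiftRight_mod_two (M n : ℕ) : (M >>> n) % 2 = (M.testBit n).toNat := by
  rw [Nat.toNat_testBit, Nat.shiftRight_eq_div_pow]

lemma bitCount_eq (M n : ℕ) : bitCount M n = ((Finset.range n).filter (M.testBit ·)).card := by
  induction n with
  | zero => rfl
  | succ n ih =>
    rw [bitCount, ih, shiftRight_mod_two, Finset.range_add_one, Finset.filter_insert]
    cases h : M.testBit n
    · simp
    · simp [add_comm]

lemma Codes.bitCount {N M : ℕ} [NeZero N] {A : Finset (ZMod N)} (h : Codes N M A) :
    bitCount M N = A.card := by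
  rw [bitCount_eq]
  refine Finset.card_bij (fun i _ => (i : ZMod N)) ?_ ?_ ?_
  · intro i hi
    exact ((h i).1 (Finset.mem_filter.1 hi).2).2
  · intro i hi j hj hij
    have hi' := Finset.mem_range.1 (Finset.mem_filter.1 hi).1
    have hj' := Finset.mem_range.1 (Finset.mem_filter.1 hj).1
    rw [← ZMod.val_natCast_of_lt hi', ← ZMod.val_natCast_of_lt hj', hij]
  · intro a ha
    refine ⟨a.val, ?_, ZMod.natCast_zmod_val a⟩
    rw [Finset.mem_filter, Finset.mem_range]
    exact ⟨ZMod.val_lt a, (h _).2 ⟨ZMod.val_lt a, by rwa [ZMod.natCast_zmod_val]⟩⟩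

lemma Codes.addTranslate {N M x : ℕ} [NeZero N] {A : Finset (ZMod N)} (h : Codes N M A)
    (hx : x < N) :
    Codes N (addTranslate N M x) (A ∪ A.image ((x : ZMod N) + ·)) := by
  intro i
  have hmem : (i : ZMod N) ∈ A ∪ A.image ((x : ZMod N) + ·) ↔
      (i : ZMod N) ∈ A ∨ (i : ZMod N) - x ∈ A := by
    rw [Finset.mem_union, Finset.mem_image]
    refine or_congr_right ⟨?_, fun h => ⟨_, h, by abel⟩⟩
    rintro ⟨a, ha, hax⟩
    rwa [← hax, add_sub_cancel_left]
  rw [hmem, _root_.addTranslate, Nat.testBit_mod_two_pow, Nat.testBit_or, Nat.testBit_or,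
    Nat.testBit_shiftLeft, Nat.testBit_shiftRight]
  simp only [Bool.and_eq_true, Bool.or_eq_true, decide_eq_true_eq, h _]
  refine and_congr_right fun hi => ?_
  rw [and_iff_right hi, or_assoc]
  refine or_congr_right ?_
  rcases le_or_gt x i with hxi | hxi
  · rw [Nat.cast_sub hxi]
    constructor
    · rintro (h1 | h1)
      · exact h1.2.2
      · omega
    · exact fun h1 => Or.inl ⟨hxi, by omega, h1⟩
  · have : ((N - x + i : ℕ) : ZMod N) = i - x := by
      rw [Nat.cast_add, Nat.cast_sub hx.le, ZMod.natCast_self]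
      ring
    rw [this]
    constructor
    · rintro (h1 | h1)
      · omega
      · exact h1.2
    · exact fun h1 => Or.inr ⟨by omega, h1⟩

lemma add_subsetSum_insert {G : Type*} [AddCommGroup G] [DecidableEq G] (A : Finset G)
    {S : Finset G} {x : G} (hx : x ∉ S) :
    A + (insert x S).subsetSum = (A ∪ A.image (x + ·)) + S.subsetSum := by
  rw [subsetSum_insert hx, Finset.add_union, Finset.union_add]
  congr 1
  ext y
  simp only [Finset.mem_add, Finset.mem_image, exists_exists_and_eq_and]
  constructor
  · rintro ⟨a, ha, s, hs, rfl⟩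
    exact ⟨a, ha, s, hs, by abel⟩
  · rintro ⟨a, ha, s, hs, rfl⟩
    exact ⟨a, ha, s, hs, by abel⟩

/-- Soundness, with invariant: `A` holds the subset sums of the elements already chosen and `R` the
elements still to come. The last hypothesis records zero-sum freeness of the whole, needed only for
pruning. -/
lemma le_card_of_minSearch {z : Bool} {N b : ℕ} [NeZero N] (x : ℕ) : ∀ (k M : ℕ)
    (A : Finset (ZMod N)) (R : Finset (ZMod N)), minSearch z N b x k M = true → Codes N M A →
    x < N → (∀ r ∈ R, r ≠ 0 ∧ r.val ≤ x) → R.card = k →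
    (z = true → ∀ T ⊆ R, T.Nonempty → -∑ t ∈ T, t ∉ A) → b ≤ (A + R.subsetSum).card := by
  induction x with
  | zero =>
    intro k M A R h hM _ hR hk _
    have : R = ∅ := Finset.eq_empty_of_forall_notMem fun r hr =>
      (hR r hr).1 ((ZMod.val_eq_zero r).1 (Nat.le_zero.1 (hR r hr).2))
    subst this
    rw [Finset.card_empty] at hk
    subst hk
    rw [minSearch, Nat.ble_eq, hM.bitCount] at h
    simpa [Finset.subsetSum] using h
  | succ x ih =>
    intro k M A R h hM hxN hR hk hz
    cases k with
    | zero =>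
      rw [Finset.card_eq_zero] at hk
      subst hk
      rw [minSearch, Nat.ble_eq, hM.bitCount] at h
      simpa [Finset.subsetSum] using h
    | succ k =>
      rw [minSearch, Bool.and_eq_true] at h
      set y : ZMod N := ((x + 1 : ℕ) : ZMod N) with hy
      have hyval : y.val = x + 1 := ZMod.val_natCast_of_lt hxN
      by_cases hyR : y ∈ R
      · have h1 : minSearch z N b x k (addTranslate N M (x + 1)) = true := by
          cases z with
          | false => simpa using h.1
          | true =>
            have h2 : ¬ M.testBit (N - (x + 1)) = true := by
              rw [hM, Nat.cast_sub hxN.le, ZMod.natCast_self, zero_sub]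
              intro h3
              refine hz rfl {y} (by simpa using hyR) (by simp) ?_
              rw [Finset.sum_singleton]
              exact h3.2
            have h3 := h.1
            rw [shiftRight_mod_two] at h3
            simpa [h2] using h3
        rw [← Finset.insert_erase hyR, add_subsetSum_insert _ (Finset.notMem_erase y R)]
        refine ih k _ _ _ h1 (hM.addTranslate hxN) (by omega) ?_ ?_ ?_
        · intro r hr
          rw [Finset.mem_erase] at hr
          refine ⟨(hR r hr.2).1, ?_⟩
          have h4 := (hR r hr.2).2
          have h5 : r.val ≠ x + 1 := fun h6 => hr.1 (ZMod.val_injective N (h6.trans hyval.symm))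
          omega
        · rw [Finset.card_erase_of_mem hyR, hk, Nat.add_sub_cancel]
        · intro hz' T hT hTne hmem
          have hyT : y ∉ T := fun h => Finset.notMem_erase y R (hT h)
          rcases Finset.mem_union.1 hmem with h4 | h4
          · exact hz hz' T (hT.trans (Finset.erase_subset _ _)) hTne h4
          · obtain ⟨a, ha, hay⟩ := Finset.mem_image.1 h4
            refine hz hz' (insert y T)
              (Finset.insert_subset hyR (hT.trans (Finset.erase_subset _ _)))
              (Finset.insert_nonempty _ _) ?_
            rw [Finset.sum_insert hyT, neg_add, ← hay]
            simpa [← hy] using ha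
      · refine ih (k + 1) M A R h.2 hM (by omega) ?_ hk hz
        intro r hr
        refine ⟨(hR r hr).1, ?_⟩
        have h4 := (hR r hr).2
        have h5 : r.val ≠ x + 1 := fun h6 => hyR (by
          rwa [← ZMod.val_injective N (h6.trans hyval.symm)])
        omega

lemma codes_one (N : ℕ) [NeZero N] : Codes N 1 {0} := by
  intro i
  rw [Nat.testBit_one_eq_true_iff_self_eq_zero, Finset.mem_singleton]
  constructor
  · rintro rfl
    exact ⟨NeZero.pos N, Nat.cast_zero⟩
  · rintro ⟨h1, h2⟩
    rw [ZMod.natCast_eq_zero_iff] at h2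
    exact Nat.eq_zero_of_dvd_of_lt h2 h1

lemma ZeroSumFree.le_card_of_minSearch {N b k : ℕ} [NeZero N] {S : Finset (ZMod N)}
    (hS : ZeroSumFree S) (hk : S.card = k) (h : minSearch true N b (N - 1) k 1 = true) :
    b ≤ S.subsetSum.card := by
  have hN := NeZero.pos N
  have := _root_.le_card_of_minSearch (N - 1) k 1 {0} S h (codes_one N) (by omega)
    (fun r hr => ⟨hS.ne_zero hr, Nat.le_sub_one_of_lt (ZMod.val_lt r)⟩) hk
    (fun _ T hT hTne => by
      rw [Finset.mem_singleton, neg_eq_zero]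
      exact hS T hT hTne)
  rwa [Finset.singleton_add, zero_vadd] at this

/-- Replacing an element x by -x merely translates the set of subset sums by -x. -/
lemma exists_subsetSum_image_eq {G : Type*} [AddCommGroup G] [DecidableEq G] {f : G → G}
    (hf : ∀ x, f x = x ∨ f x = -x) (S : Finset G) (hinj : Set.InjOn f S) :
    ∃ t, (S.image f).subsetSum = S.subsetSum.image (t + ·) := by
  induction S using Finset.induction_on with
  | empty => exact ⟨0, by simp [Finset.subsetSum]⟩
  | insert x S hx ih =>
    obtain ⟨t, ht⟩ := ih (hinj.mono (by simp))
    have hfx : f x ∉ S.image f := by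
      intro h
      obtain ⟨y, hy, hyx⟩ := Finset.mem_image.1 h
      exact hx (hinj (by simp [hy]) (by simp) hyx ▸ hy)
    rw [Finset.image_insert, subsetSum_insert hfx, subsetSum_insert hx, ht]
    simp only [Finset.image_union, Finset.image_image, Function.comp_def]
    rcases hf x with h | h <;> rw [h]
    · exact ⟨t, by simp only [add_left_comm]⟩
    · refine ⟨-x + t, ?_⟩
      rw [Finset.union_comm]
      congr 1 <;> refine Finset.image_congr fun a _ => ?_
      · abel
      · abel

/-- Sign changes move all elements into `{1, …, (N - 1) / 2}` without changing the number of sums.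
They need not preserve zero-sum freeness, so the search runs without pruning. -/
lemma ZeroSumFree.le_card_of_minSearch_half {N b k : ℕ} [NeZero N] (hN : Odd N)
    {S : Finset (ZMod N)} (hS : ZeroSumFree S) (hk : S.card = k)
    (h : minSearch false N b ((N - 1) / 2) k 1 = true) : b ≤ S.subsetSum.card := by
  have hN0 := NeZero.pos N
  have hodd : Odd (Nat.card (ZMod N)) := by rwa [Nat.card_zmod]
  set f : ZMod N → ZMod N := fun x => if x.val ≤ (N - 1) / 2 then x else -x with hf
  have hf' : ∀ x, f x = x ∨ f x = -x := fun x => by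
    simp only [hf]; split_ifs <;> simp
  have hinj : Set.InjOn f S := by
    intro x hx y hy hxy
    have hn := fun z (hz : z ∈ S) =>
      hS.neg_notMem_self (fun _ => eq_zero_of_add_self_eq_zero hodd) hz
    rcases hf' x with h1 | h1 <;> rcases hf' y with h2 | h2 <;> rw [h1, h2] at hxy
    · exact hxy
    · exact absurd (hxy ▸ hx) (hn y hy)
    · exact absurd (hxy ▸ hy) (hn x hx)
    · exact neg_injective hxy
  obtain ⟨t, ht⟩ := exists_subsetSum_image_eq hf' S hinj
  have := _root_.le_card_of_minSearch ((N - 1) / 2) k 1 {0} (S.image f) h (codes_one N) (by omega)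
    (fun r hr => by
      obtain ⟨s, hs, rfl⟩ := Finset.mem_image.1 hr
      have h0 := hS.ne_zero hs
      refine ⟨by rcases hf' s with h | h <;> rw [h] <;> simpa using h0, ?_⟩
      simp only [hf]
      split_ifs with h1
      · exact h1
      · rw [ZMod.neg_val, if_neg h0]
        obtain ⟨m, rfl⟩ := hN
        omega)
    (by rw [Finset.card_image_of_injOn hinj, hk]) (by simp)
  rwa [Finset.singleton_add, zero_vadd, ht,
    Finset.card_image_of_injective _ (add_right_injective t)] at this

lemma subsetSum_image_hom {G H : Type*} [AddCommGroup G] [AddCommGroup H] [DecidableEq G]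
    [DecidableEq H] (f : G →+ H) (hf : Function.Injective f) (S : Finset G) :
    (S.image f).subsetSum = S.subsetSum.image f := by
  induction S using Finset.induction_on with
  | empty => simp [Finset.subsetSum]
  | insert x S hx ih =>
    rw [Finset.image_insert, subsetSum_insert (by simpa [hf.eq_iff] using hx), subsetSum_insert hx,
      ih, Finset.image_union, Finset.image_image, Finset.image_image]
    congr 2
    ext y
    simp

/-- The subgroup generated by `S` is cyclic, so only its order matters. -/
lemma ZeroSumFree.exists_zmod {G : Type*} [AddCommGroup G] [IsAddCyclic G] [DecidableEq G]
    {S : Finset G} (hS : ZeroSumFree S) {N : ℕ}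
    (hN : Nat.card (AddSubgroup.closure (S : Set G)) = N) :
    ∃ R : Finset (ZMod N), ZeroSumFree R ∧ R.card = S.card ∧
      R.subsetSum.card = S.subsetSum.card := by
  subst hN
  set K := AddSubgroup.closure (S : Set G)
  set e := zmodAddCyclicAddEquiv (inferInstance : IsAddCyclic K)
  set f : ZMod (Nat.card K) →+ G := K.subtype.comp e.toAddMonoidHom with hfdef
  have hf : Function.Injective f := K.subtype_injective.comp e.injective
  have hS' : ∃ R : Finset (ZMod (Nat.card K)), R.image f = S := by
    refine ⟨S.attach.image fun x => e.symm ⟨x.1, AddSubgroup.subset_closure x.2⟩, ?_⟩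
    rw [Finset.image_image]
    ext y
    simp [hfdef, Function.comp_def]
  obtain ⟨R, hR⟩ := hS'
  refine ⟨R, ?_, by rw [← hR, Finset.card_image_of_injective _ hf],
    by rw [← hR, subsetSum_image_hom f hf, Finset.card_image_of_injective _ hf]⟩
  intro T hT hTne hsum
  refine hS (T.image f) (hR ▸ Finset.image_subset_image hT) (hTne.image f) ?_
  rw [Finset.sum_image hf.injOn, ← map_sum, hsum, map_zero]

/-! ### Four, five and six elements generating a small subgroup -/

section SmallClosure

variable {G : Type*} [AddCommGroup G] [IsAddCyclic G] [DecidableEq G] {S : Finset G}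

omit [IsAddCyclic G] [DecidableEq G] in
lemma odd_card_closure (hodd : Odd (Nat.card G)) (S : Set G) :
    Odd (Nat.card (AddSubgroup.closure S)) :=
  hodd.of_dvd_nat (AddSubgroup.card_addSubgroup_dvd_card _)

set_option maxRecDepth 100000 in
lemma ZeroSumFree.card_four_of_small (hodd : Odd (Nat.card G)) (hS : ZeroSumFree S)
    (h4 : S.card = 4) (hN : Nat.card (AddSubgroup.closure (S : Set G)) ≤ 14) :
    10 ≤ S.subsetSum.card ∨
      9 ≤ S.subsetSum.card ∧ Nat.card (AddSubgroup.closure (S : Set G)) = 9 := by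
  have ho := odd_card_closure hodd (S : Set G)
  generalize hNe : Nat.card (AddSubgroup.closure (S : Set G)) = N at *
  obtain ⟨R, hR, hRc, hRs⟩ := hS.exists_zmod hNe
  rw [← hRs]
  have hpos : NeZero N := ⟨by rintro rfl; simp at ho⟩
  -- Moduli too small to contain four zero-sum free elements pass vacuously. Modulus 9 is separate,
  -- as ten sums cannot fit there.
  have key : ∀ n ∈ [1, 3, 5, 7, 11, 13], minSearch true n 10 (n - 1) 4 1 = true := by decide +kernel
  have key9 : minSearch true 9 9 8 4 1 = true := by decide +kernel
  by_cases h9 : N = 9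
  · subst h9
    exact Or.inr ⟨hR.le_card_of_minSearch (hRc.trans h4) key9, rfl⟩
  · refine Or.inl (hR.le_card_of_minSearch (hRc.trans h4) (key N ?_))
    interval_cases N <;> first | decide | (revert ho; decide) | omega

set_option maxRecDepth 100000 in
lemma ZeroSumFree.card_five_of_small (hodd : Odd (Nat.card G)) (hS : ZeroSumFree S)
    (h5 : S.card = 5) (hN : Nat.card (AddSubgroup.closure (S : Set G)) ≤ 20) :
    15 ≤ S.subsetSum.card := by
  have ho := odd_card_closure hodd (S : Set G)
  generalize hNe : Nat.card (AddSubgroup.closure (S : Set G)) = N at *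
  obtain ⟨R, hR, hRc, hRs⟩ := hS.exists_zmod hNe
  rw [← hRs]
  have hpos : NeZero N := ⟨by rintro rfl; simp at ho⟩
  have key : ∀ n ∈ [1, 3, 5, 7, 9, 11, 13, 15, 17, 19], minSearch true n 15 (n - 1) 5 1 = true := by
    decide +kernel
  refine hR.le_card_of_minSearch (hRc.trans h5) (key N ?_)
  interval_cases N <;> first | decide | (revert ho; decide)

set_option maxRecDepth 100000 in
lemma ZeroSumFree.card_six_of_small (hodd : Odd (Nat.card G)) (hS : ZeroSumFree S)
    (h6 : S.card = 6) (hN : Nat.card (AddSubgroup.closure (S : Set G)) ≤ 30) :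
    21 ≤ S.subsetSum.card := by
  have ho := odd_card_closure hodd (S : Set G)
  generalize hNe : Nat.card (AddSubgroup.closure (S : Set G)) = N at *
  obtain ⟨R, hR, hRc, hRs⟩ := hS.exists_zmod hNe
  rw [← hRs]
  have hpos : NeZero N := ⟨by rintro rfl; simp at ho⟩
  have key : ∀ n ∈ [1, 3, 5, 7, 9, 11, 13, 15, 17, 19, 21],
      minSearch true n 21 (n - 1) 6 1 = true := by decide +kernel
  have key' : ∀ n ∈ [23, 25, 27, 29], minSearch false n 21 ((n - 1) / 2) 6 1 = true := by
    decide +kernel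
  rcases le_or_gt N 22 with h | h
  · refine hR.le_card_of_minSearch (hRc.trans h6) (key N ?_)
    interval_cases N <;> first | decide | (revert ho; decide)
  · refine hR.le_card_of_minSearch_half ho (hRc.trans h6) (key' N ?_)
    interval_cases N <;> first | decide | (revert ho; decide)

end SmallClosure

end Search

/-! ### Two and three elements, and triples with all eight sums distinct -/

section FewElements

variable {G : Type*} [AddCommGroup G] [DecidableEq G]

lemma subsetSum_empty : (∅ : Finset G).subsetSum = {0} := by simp [Finset.subsetSum]

lemma subsetSum_pair {a b : G} (h : a ≠ b) : ({a, b} : Finset G).subsetSum = {0, a, b, a + b} := by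
  have hb : ({b} : Finset G).subsetSum = {0, b} := by
    rw [← insert_empty_eq, subsetSum_insert (by simp), subsetSum_empty]
    ext; simp
  rw [subsetSum_insert (by simpa using h), hb]
  ext y
  simp only [Finset.mem_union, Finset.mem_insert, Finset.mem_singleton, Finset.mem_image]
  constructor
  · rintro ((h | h) | ⟨z, rfl | rfl, rfl⟩) <;> simp_all
  · rintro (h | h | h | h)
    · simp [h]
    · exact Or.inr ⟨0, by simp [h]⟩
    · simp [h]
    · exact Or.inr ⟨b, by simp [h]⟩

/-- One of three elements is the sum of the two others. -/
def IsSchurTriple (a b c : G) : Prop := a = b + c ∨ b = a + c ∨ c = a + b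

lemma ZeroSumFree.triple_facts {a b c : G} (hab : a ≠ b) (hac : a ≠ c) (hbc : b ≠ c)
    (hS : ZeroSumFree ({a, b, c} : Finset G)) :
    a ≠ 0 ∧ b ≠ 0 ∧ c ≠ 0 ∧ a + b ≠ 0 ∧ a + c ≠ 0 ∧ b + c ≠ 0 ∧ a + b + c ≠ 0 := by
  refine ⟨hS.ne_zero (by simp), hS.ne_zero (by simp), hS.ne_zero (by simp), ?_, ?_, ?_, ?_⟩
  · rw [← Finset.sum_pair (f := fun x => x) hab]; exact hS _ (by grind) (by simp)
  · rw [← Finset.sum_pair (f := fun x => x) hac]; exact hS _ (by grind) (by simp)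
  · rw [← Finset.sum_pair (f := fun x => x) hbc]; exact hS _ (by grind) (by simp)
  · have := hS {a, b, c} subset_rfl (by simp)
    rwa [Finset.sum_insert (by simp [hab, hac]), Finset.sum_pair hbc, ← add_assoc] at this

lemma ZeroSumFree.card_triple {a b c : G} (h2 : ∀ x : G, x + x = 0 → x = 0) (hab : a ≠ b)
    (hac : a ≠ c) (hbc : b ≠ c) (hS : ZeroSumFree ({a, b, c} : Finset G)) :
    7 ≤ ({a, b, c} : Finset G).subsetSum.card ∧
      (¬ IsSchurTriple a b c → 8 ≤ ({a, b, c} : Finset G).subsetSum.card) := by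
  have h := hS.triple_facts hab hac hbc
  have heq : ({a, b, c} : Finset G) = insert c {a, b} := by grind
  have h4 : ({a, b} : Finset G).subsetSum.card = 4 := by
    have h5 := hS.mono (T := {a, b}) (by grind)
    rw [subsetSum_pair hab, Finset.card_insert_of_notMem, Finset.card_insert_of_notMem,
      Finset.card_pair] <;> simp <;> grind
  have hc := card_subsetSum_insert (S := {a, b}) (x := c) (by grind)
  rw [← heq, h4] at hc
  have hmem : ∀ u : G, u ∈ ({a, b} : Finset G).subsetSum ↔ u = 0 ∨ u = a ∨ u = b ∨ u = a + b := by
    intro u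
    rw [subsetSum_pair hab]
    simp
  constructor
  · have : diffRep ({a, b} : Finset G).subsetSum c ≤ 1 := by
      refine Finset.card_le_one.2 fun u hu v hv => ?_
      rw [Finset.mem_filter, hmem, hmem] at hu hv
      have := h2 a
      have := h2 b
      have := h2 c
      have hcancel : ∀ x y z : G, x + y = x + z → y = z := fun x y z h => add_left_cancel h
      grind
    omega
  · intro hs
    have : diffRep ({a, b} : Finset G).subsetSum c = 0 := by
      refine Finset.card_eq_zero.2 (Finset.eq_empty_of_forall_notMem fun u hu => ?_)
      rw [Finset.mem_filter, hmem, hmem] at hu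
      unfold IsSchurTriple at hs
      grind
    omega

lemma ZeroSumFree.card_two {S : Finset G} (hS : ZeroSumFree S)
    (h : S.card = 2) : 4 ≤ S.subsetSum.card := by
  obtain ⟨a, b, hab, rfl⟩ := Finset.card_eq_two.1 h
  have h1 := hS.ne_zero (x := a) (by simp)
  have h2 := hS.ne_zero (x := b) (by simp)
  have h3 := hS {a, b} subset_rfl (by simp)
  rw [Finset.sum_pair hab] at h3
  rw [subsetSum_pair hab, Finset.card_insert_of_notMem, Finset.card_insert_of_notMem,
    Finset.card_pair] <;> simp <;> grind

lemma ZeroSumFree.card_three (hodd : Odd (Nat.card G)) {S : Finset G} (hS : ZeroSumFree S)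
    (h : S.card = 3) : 7 ≤ S.subsetSum.card := by
  obtain ⟨a, b, c, hab, hac, hbc, rfl⟩ := Finset.card_eq_three.1 h
  exact (hS.card_triple (fun _ => eq_zero_of_add_self_eq_zero hodd) hab hac hbc).1

/-- Among four zero-sum free elements there are three with all subset sums distinct. -/
lemma ZeroSumFree.exists_card_erase_ge (hodd : Odd (Nat.card G)) {S : Finset G}
    (hS : ZeroSumFree S) (h : S.card = 4) : ∃ q ∈ S, 8 ≤ (S.erase q).subsetSum.card := by
  have h2 : ∀ x : G, x + x = 0 → x = 0 := fun _ => eq_zero_of_add_self_eq_zero hodd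
  obtain ⟨d, T, hd, rfl, hT⟩ := Finset.card_eq_succ.1 h
  obtain ⟨a, b, c, hab, hac, hbc, rfl⟩ := Finset.card_eq_three.1 hT
  simp only [Finset.mem_insert, Finset.mem_singleton, not_or] at hd
  obtain ⟨had, hbd, hcd⟩ := hd
  have zabc : ZeroSumFree ({a, b, c} : Finset G) := hS.mono (by grind)
  have zabd : ZeroSumFree ({a, b, d} : Finset G) := hS.mono (by grind)
  have zacd : ZeroSumFree ({a, c, d} : Finset G) := hS.mono (by grind)
  have zbcd : ZeroSumFree ({b, c, d} : Finset G) := hS.mono (by grind)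
  have fabc := zabc.triple_facts hab hac hbc
  have fabd := zabd.triple_facts hab (Ne.symm had) (Ne.symm hbd)
  have facd := zacd.triple_facts hac (Ne.symm had) (Ne.symm hcd)
  have fbcd := zbcd.triple_facts hbc (Ne.symm hbd) (Ne.symm hcd)
  have key : ¬ (IsSchurTriple a b c ∧ IsSchurTriple a b d ∧ IsSchurTriple a c d ∧
      IsSchurTriple b c d) := by
    unfold IsSchurTriple
    have := h2 a
    have := h2 b
    have := h2 c
    have := h2 d
    have hcancel : ∀ x y z : G, x + y = x + z → y = z := fun x y z h => add_left_cancel h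
    grind
  by_cases s1 : IsSchurTriple a b c
  · by_cases s2 : IsSchurTriple a b d
    · by_cases s3 : IsSchurTriple a c d
      · refine ⟨a, by simp, ?_⟩
        rw [show (insert d {a, b, c} : Finset G).erase a = {b, c, d} by grind]
        exact (zbcd.card_triple h2 hbc (Ne.symm hbd) (Ne.symm hcd)).2 fun s4 =>
          key ⟨s1, s2, s3, s4⟩
      · refine ⟨b, by simp, ?_⟩
        rw [show (insert d {a, b, c} : Finset G).erase b = {a, c, d} by grind]
        exact (zacd.card_triple h2 hac (Ne.symm had) (Ne.symm hcd)).2 s3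
    · refine ⟨c, by simp, ?_⟩
      rw [show (insert d {a, b, c} : Finset G).erase c = {a, b, d} by grind]
      exact (zabd.card_triple h2 hab (Ne.symm had) (Ne.symm hbd)).2 s2
  · refine ⟨d, by simp, ?_⟩
    rw [show (insert d {a, b, c} : Finset G).erase d = {a, b, c} by grind]
    exact (zabc.card_triple h2 hab hac hbc).2 s1

end FewElements

/-! ### Popular differences, and the bound for four elements -/

section Popular

variable {G : Type*} [AddCommGroup G] [Fintype G] [DecidableEq G]

lemma card_le_popular {B X : Finset G} {t : ℕ} (h : ∀ x ∈ X, t < diffRep B x) :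
    X.card ≤ (popular B t).card :=
  Finset.card_le_card fun x hx => by simpa [popular] using h x hx

lemma one_le_popular {B : Finset G} {t : ℕ} (ht : t < B.card) : 1 ≤ (popular B t).card :=
  card_le_popular (X := {0}) (by simpa [diffRep_zero] using ht)

/-- By subadditivity of the defect, a sum of two elements of `C` has at least `2 * s - B.card`
representations. -/
lemma card_double_le_popular {B C : Finset G} {s t : ℕ} (h : ∀ x ∈ C, s ≤ diffRep B x)
    (ht : t + B.card < 2 * s) : (C + C).card ≤ (popular B t).card := by
  refine card_le_popular fun x hx => ?_
  obtain ⟨y, hy, z, hz, rfl⟩ := Finset.mem_add.1 hx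
  have := diffRep_add B y z
  have := h y hy
  have := h z hz
  omega

lemma card_triple_le_popular {B C : Finset G} {s t : ℕ} (h : ∀ x ∈ C, s ≤ diffRep B x)
    (ht : t + 2 * B.card < 3 * s) : (C + C + C).card ≤ (popular B t).card := by
  refine card_le_popular fun x hx => ?_
  obtain ⟨u, hu, w, hw, rfl⟩ := Finset.mem_add.1 hx
  obtain ⟨y, hy, z, hz, rfl⟩ := Finset.mem_add.1 hu
  have := diffRep_add B y z
  have := diffRep_add B (y + z) w
  have := h y hy
  have := h z hz
  have := h w hw
  omega

omit [Fintype G] in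
lemma le_diffRep_symHull {B S : Finset G} {s : ℕ} (hs : s ≤ B.card)
    (h : ∀ x ∈ S, s ≤ diffRep B x) : ∀ x ∈ symHull S, s ≤ diffRep B x := by
  intro x hx
  rcases mem_symHull.1 hx with rfl | hx | hx
  · rwa [diffRep_zero]
  · exact h x hx
  · rw [← diffRep_neg]
    exact h _ hx

omit [Fintype G] in
lemma card_erase_le_diffRep {S : Finset G} {x : G} (hx : x ∈ S) :
    (S.erase x).subsetSum.card ≤ diffRep S.subsetSum x := by
  have := card_subsetSum_le_diffRep (Finset.notMem_erase x S)
  rwa [Finset.insert_erase hx] at this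

omit [Fintype G] in
lemma card_subsetSum_mono {S T : Finset G} (h : S ⊆ T) : S.subsetSum.card ≤ T.subsetSum.card :=
  Finset.card_le_card (Finset.subsetSum_mono h)

omit [Fintype G] in
/-- Every `symHull` element is popular if all one-element deletions have many subset sums. -/
lemma le_diffRep_symHull_of_erase {S : Finset G} {s : ℕ} (hne : S.Nonempty)
    (h : ∀ x ∈ S, s ≤ (S.erase x).subsetSum.card) :
    ∀ x ∈ symHull S, s ≤ diffRep S.subsetSum x := by
  obtain ⟨y, hy⟩ := hne
  exact le_diffRep_symHull ((h y hy).trans (card_subsetSum_mono (Finset.erase_subset _ _)))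
    fun x hx => (h x hx).trans (card_erase_le_diffRep hx)

lemma ZeroSumFree.card_four (hodd : Odd (Nat.card G)) {S : Finset G} (hS : ZeroSumFree S)
    (h4 : S.card = 4) (hN : 15 ≤ Nat.card (AddSubgroup.closure (S : Set G))) :
    10 ≤ S.subsetSum.card := by
  by_contra! hlt
  have h7 : ∀ x ∈ S, 7 ≤ (S.erase x).subsetSum.card := fun x hx =>
    (hS.mono (Finset.erase_subset x S)).card_three hodd
      (by rw [Finset.card_erase_of_mem hx, h4])
  have hne : S.Nonempty := Finset.card_pos.1 (by omega)
  have hr := le_diffRep_symHull_of_erase hne h7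
  have hge : 7 ≤ S.subsetSum.card := by
    simpa [diffRep_zero] using hr 0 (zero_mem_symHull S)
  have hC := card_symHull hodd hS
  rw [h4] at hC
  have h2C := card_double_symHull_ge hodd hS hN (Or.inl ⟨h4, le_rfl⟩)
  have hsum := sum_card_popular S.subsetSum
  have p1 : ∀ t, t < S.subsetSum.card → 1 ≤ (popular S.subsetSum t).card :=
    fun t ht => one_le_popular ht
  have p2 : ∀ t, t < 7 → 9 ≤ (popular S.subsetSum t).card :=
    fun t ht => hC.ge.trans <| card_le_popular fun x hx => ht.trans_le (hr x hx)
  have p3 : ∀ t, t + S.subsetSum.card < 14 → 15 ≤ (popular S.subsetSum t).card :=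
    fun t ht => h2C.trans (card_double_le_popular hr ht)
  generalize hb : S.subsetSum.card = b at *
  -- Elements of the symmetric hull have at least 7 representations and sums of two at least `14 -
  -- b`, so the layers have at least 15, 9 or 1 elements. For `b` from 7 to 9 this exceeds `b ^ 2`.
  have hb' : ∑ t ∈ Finset.range b,
      (if t + b < 14 then 15 else if t < 7 then 9 else 1) ≤ b ^ 2 := by
    rw [← hsum]
    refine Finset.sum_le_sum fun t ht => ?_
    have := Finset.mem_range.1 ht
    split_ifs with h1 h2
    · exact p3 t h1
    · exact p2 t h2
    · exact p1 t this
  interval_cases b <;> revert hb' <;> decide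

/-- `w` is a difference of two subset sums of `S`. -/
def IsSumDiff (S : Finset G) (w : G) : Prop := ∃ u ∈ S.subsetSum, u + w ∈ S.subsetSum

omit [Fintype G] in
lemma IsSumDiff.insert {S : Finset G} {w q y : G} (h : IsSumDiff S w) (hq : q ∉ S)
    (hy : y = q ∨ y = -q) : IsSumDiff (insert q S) (w + y) := by
  obtain ⟨u, hu, huw⟩ := h
  unfold IsSumDiff
  rw [subsetSum_insert hq]
  rcases hy with rfl | rfl
  · exact ⟨u, Finset.mem_union_left _ hu, Finset.mem_union_right _
      (Finset.mem_image.2 ⟨_, huw, by abel⟩)⟩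
  · exact ⟨q + u, Finset.mem_union_right _ (Finset.mem_image.2 ⟨_, hu, rfl⟩),
      Finset.mem_union_left _ (by convert huw using 1; abel)⟩

-- A representation using only `S` can be shifted by the unused element `q`, which gives a second
-- one.
omit [Fintype G] in
lemma IsSumDiff.two_le_diffRep {S : Finset G} {w q : G} (h : IsSumDiff S w) (hq : q ∉ S)
    (hq0 : q ≠ 0) : 2 ≤ diffRep (Insert.insert q S).subsetSum w := by
  obtain ⟨u, hu, huw⟩ := h
  have hne : u ≠ q + u := by simpa using hq0
  rw [← Finset.card_pair hne, diffRep, subsetSum_insert hq]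
  refine Finset.card_le_card (Finset.insert_subset ?_ (Finset.singleton_subset_iff.2 ?_)) <;>
    simp only [Finset.mem_filter, Finset.mem_union, Finset.mem_image]
  · exact ⟨Or.inl hu, Or.inl huw⟩
  · exact ⟨Or.inr ⟨u, hu, rfl⟩, Or.inr ⟨_, huw, by abel⟩⟩

end Popular

/-! ### The bounds for five and six elements -/

section FiveAndSix

variable {G : Type*} [AddCommGroup G] [Fintype G] [DecidableEq G]

/-- If `{0} ∪ Q ∪ -Q` has a small sumset then some signed sum of three elements is not in it. -/
lemma ZeroSumFree.exists_signed_sum_notMem (hodd : Odd (Nat.card G)) {Q : Finset G}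
    (hQ : ZeroSumFree Q) (h4 : Q.card = 4)
    (hN : 21 ≤ Nat.card (AddSubgroup.closure (Q : Set G)))
    (h15 : (symHull Q + symHull Q).card ≤ 15) :
    ∃ x ∈ symHull Q, ∃ y ∈ symHull Q, ∃ z ∈ symHull Q, x ≠ 0 ∧ y ≠ 0 ∧ z ≠ 0 ∧
      x ≠ y ∧ x ≠ z ∧ y ≠ z ∧ x ≠ -y ∧ x ≠ -z ∧ y ≠ -z ∧ x + y + z ∉ symHull Q + symHull Q := by
  have h2 : ∀ x : G, x + x = 0 → x = 0 := fun _ => eq_zero_of_add_self_eq_zero hodd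
  set C := symHull Q with hCdef
  have hC : C.card = 9 := by rw [hCdef, card_symHull hodd hQ, h4]
  have h0 : (0 : G) ∈ C := zero_mem_symHull Q
  have hneg : ∀ x ∈ C, -x ∈ C := neg_mem_symHull
  have h3C := card_triple_symHull_ge hodd hQ hN (Or.inl ⟨h4, le_rfl⟩)
  rw [← hCdef] at h3C
  rcases card_double_symHull hodd Q with h | ⟨H, hH, hle, hHodd, m, hm, hm3, hmH⟩
  · rw [← hCdef] at h; omega
  rw [← hCdef] at hH hle hmH
  have hsub := subset_cosetHull C H
  have hsubc := Finset.card_le_card hsub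
  -- Period 1 would force 17 elements in the double sumset and period at least 5 would force 25.
  have hH3 : Nat.card H = 3 := by
    rw [hmH] at hle hsubc
    obtain ⟨k, rfl⟩ := hm
    rcases odd_cases hHodd with h5 | h5 | h5
    · rw [h5] at hle hsubc; omega
    · exact h5
    · have : 2 * ((2 * k + 1) * Nat.card H) = (4 * k + 1) * Nat.card H + Nat.card H := by ring
      have h6 : 5 * 5 ≤ (4 * k + 1) * Nat.card H := Nat.mul_le_mul (by omega) h5
      omega
  have hCC : C = cosetHull C H := Finset.eq_of_subset_of_card_le hsub (by omega)
  have hper : IsPeriodic C H := by rw [hCC]; exact isPeriodic_cosetHull C H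
  have h3 : ∀ h ∈ H, h + h + h = 0 := by
    intro h hh
    have : Nat.card H • (⟨h, hh⟩ : H) = 0 := card_nsmul_eq_zero'
    rw [hH3] at this
    have := congrArg (Subtype.val) this
    simpa [succ_nsmul] using this
  have hhalf : ∀ y, y + y ∈ H → y ∈ H := by
    intro y hy
    have h5 : y + y + y = 0 := h2 _ (by rw [← h3 _ hy]; abel)
    have : y = -(y + y) := by rw [eq_neg_iff_add_eq_zero, ← h5]; abel
    rw [this]
    exact H.neg_mem hy
  classical
  set F : Finset G := Finset.univ.filter (· ∈ H) with hF
  have hFc : F.card = 3 := by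
    rw [← hH3, Nat.card_eq_fintype_card, Fintype.card_subtype]
  have hFmem : ∀ x, x ∈ F ↔ x ∈ H := by simp [hF]
  obtain ⟨y, hyC, hyF⟩ : ∃ y ∈ C, y ∉ F := by
    by_contra! h
    have := Finset.card_le_card (show C ⊆ F from h)
    omega
  obtain ⟨h, hhF, hh0⟩ := Finset.exists_mem_ne (s := F) (by omega) 0
  rw [hFmem] at hyF hhF
  have hy2 : y + y ∉ H := fun h => hyF (hhalf y h)
  -- With nine elements and period of order 3, the set `C` consists of exactly the cosets of 0, `y`
  -- and `-y`.
  have hXC : F ∪ (F.image (· + y) ∪ F.image (· + -y)) = C := by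
    refine Finset.eq_of_subset_of_card_le ?_ ?_
    · refine Finset.union_subset (fun x hx => ?_) (Finset.union_subset ?_ ?_)
      · simpa using hper x ((hFmem x).1 hx) 0 h0
      · exact Finset.image_subset_iff.2 fun x hx => hper x ((hFmem x).1 hx) y hyC
      · exact Finset.image_subset_iff.2 fun x hx => hper x ((hFmem x).1 hx) (-y) (hneg y hyC)
    · rw [Finset.card_union_of_disjoint, Finset.card_union_of_disjoint,
        Finset.card_image_of_injective _ (add_left_injective _),
        Finset.card_image_of_injective _ (add_left_injective _), hFc, hC]
      · rw [Finset.disjoint_left]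
        simp only [Finset.mem_image, hFmem]
        rintro _ ⟨a, ha, rfl⟩ ⟨b, hb, hab⟩
        refine hy2 ?_
        have hb' : b = a + y + y := by rw [← hab]; abel
        rw [show y + y = b - a by rw [hb']; abel]
        exact H.sub_mem hb ha
      · rw [Finset.disjoint_left]
        simp only [Finset.mem_union, Finset.mem_image, hFmem]
        rintro _ ha (⟨b, hb, rfl⟩ | ⟨b, hb, rfl⟩)
        · exact hyF (by simpa using H.sub_mem ha hb)
        · exact hyF (by simpa using H.sub_mem hb ha)
  have hform : ∀ c ∈ C, ∃ j : ℤ, -1 ≤ j ∧ j ≤ 1 ∧ c - j • y ∈ H := by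
    intro c hc
    rw [← hXC, Finset.mem_union, Finset.mem_union, Finset.mem_image, Finset.mem_image] at hc
    rcases hc with hc | ⟨a, ha, rfl⟩ | ⟨a, ha, rfl⟩
    · exact ⟨0, by simp, by simp, by simpa using (hFmem c).1 hc⟩
    · exact ⟨1, by simp, by simp, by simpa using (hFmem a).1 ha⟩
    · exact ⟨-1, by simp, by simp, by simpa using (hFmem a).1 ha⟩
  -- Modulo `H`, a triple sum is a multiple of `y` between -3 and 3. If `3y` were in `C + C`, all of
  -- `C + C + C` would be, contradicting its 21 elements. The witnesses below are `y`, `y + h`, `y -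
  -- h`, with sum `3y`.
  have h3y : y + y + y ∉ C + C := by
    intro hy3
    have hsubset : C + C + C ⊆ C + C := by
      intro w hw
      obtain ⟨v, hv, c₃, hc₃, rfl⟩ := Finset.mem_add.1 hw
      obtain ⟨c₁, hc₁, c₂, hc₂, rfl⟩ := Finset.mem_add.1 hv
      obtain ⟨i, hi1, hi2, hi⟩ := hform c₁ hc₁
      obtain ⟨j, hj1, hj2, hj⟩ := hform c₂ hc₂
      obtain ⟨k, hk1, hk2, hk⟩ := hform c₃ hc₃
      have hmul : ∀ n : ℤ, -3 ≤ n → n ≤ 3 → n • y ∈ C + C := by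
        have hcc : ∀ w ∈ C + C, -w ∈ C + C := by
          intro w hw
          obtain ⟨a, ha, b, hb, rfl⟩ := Finset.mem_add.1 hw
          exact Finset.mem_add.2 ⟨-a, hneg a ha, -b, hneg b hb, by abel⟩
        have hpos : ∀ n : ℕ, n ≤ 3 → (n : ℤ) • y ∈ C + C := by
          intro n hn
          rw [natCast_zsmul]
          interval_cases n
          · exact Finset.mem_add.2 ⟨0, h0, 0, h0, by simp⟩
          · exact Finset.mem_add.2 ⟨y, hyC, 0, h0, by simp⟩
          · exact Finset.mem_add.2 ⟨y, hyC, y, hyC, (two_nsmul y).symm⟩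
          · convert hy3 using 1; simp [succ_nsmul]
        intro n hn1 hn2
        obtain ⟨l, rfl | rfl⟩ := n.eq_nat_or_neg
        · exact hpos l (by omega)
        · rw [neg_smul]; exact hcc _ (hpos l (by omega))
      have := hH _ (H.add_mem (H.add_mem hi hj) hk) _ (hmul (i + j + k) (by omega) (by omega))
      convert this using 1
      module
    have := Finset.card_le_card hsubset
    omega
  have hyh : ∀ k ∈ H, y + k ∉ H := fun k hk hyk => hyF (by simpa using H.sub_mem hyk hk)
  have hne0 : ∀ k ∈ H, y + k ≠ 0 := fun k hk h => hyh k hk (h ▸ H.zero_mem)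
  have hneN : ∀ k ∈ H, ∀ l ∈ H, y + k ≠ -(y + l) := by
    intro k hk l hl h
    refine hy2 ?_
    rw [eq_neg_iff_add_eq_zero] at h
    have : y + y = -(k + l) := by rw [eq_neg_iff_add_eq_zero, ← h]; abel
    rw [this]
    exact H.neg_mem (H.add_mem hk hl)
  have hnh : -h ∈ H := H.neg_mem hhF
  have hhh : h ≠ -h := fun h' => hh0 (h2 h (by nth_rw 2 [h']; simp))
  have hmem : ∀ k ∈ H, y + k ∈ C := fun k hk => by rw [add_comm]; exact hper k hk y hyC
  refine ⟨y + 0, hmem 0 H.zero_mem, y + h, hmem h hhF, y + -h, hmem _ hnh, hne0 _ H.zero_mem,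
    hne0 _ hhF, hne0 _ hnh, ?_, ?_, ?_, hneN _ H.zero_mem _ hhF, hneN _ H.zero_mem _ hnh,
    hneN _ hhF _ hnh, ?_⟩
  · simpa using hh0
  · simpa using hh0
  · simpa using hhh
  · rwa [show y + 0 + (y + h) + (y + -h) = y + y + y by abel]

omit [Fintype G] in
lemma mem_symHull_of_ne_zero {S : Finset G} {x : G} (hx : x ∈ symHull S) (h0 : x ≠ 0) :
    ∃ q ∈ S, x = q ∨ x = -q := by
  rcases mem_symHull.1 hx with h | h | h
  · exact absurd h h0
  · exact ⟨x, h, Or.inl rfl⟩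
  · exact ⟨-x, h, Or.inr (by simp)⟩

/-- If the double sumset has only 15 elements, some signed sum of three elements of `Q` lies outside
it. The fourth element of `Q` gives that sum a second representation, so it is a sixteenth popular
element. -/
lemma ZeroSumFree.sixteen_le_popular (hodd : Odd (Nat.card G)) {Q : Finset G}
    (hQ : ZeroSumFree Q) (h4 : Q.card = 4)
    (hN : 21 ≤ Nat.card (AddSubgroup.closure (Q : Set G)))
    (hr : ∀ x ∈ symHull Q + symHull Q, 2 ≤ diffRep Q.subsetSum x) :
    16 ≤ (popular Q.subsetSum 1).card := by
  by_contra! hlt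
  have h15 := card_double_symHull_ge hodd hQ (n := 15) (by omega) (Or.inl ⟨h4, le_rfl⟩)
  have hle := card_le_popular (t := 1) hr
  obtain ⟨x, hx, y, hy, z, hz, hx0, hy0, hz0, hxy, hxz, hyz, hxy', hxz', hyz', hw⟩ :=
    hQ.exists_signed_sum_notMem hodd h4 hN (by omega)
  obtain ⟨a, ha, hxa⟩ := mem_symHull_of_ne_zero hx hx0
  obtain ⟨b, hb, hyb⟩ := mem_symHull_of_ne_zero hy hy0
  obtain ⟨c, hc, hzc⟩ := mem_symHull_of_ne_zero hz hz0
  have hab : a ≠ b := by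
    rintro rfl
    rcases hxa with rfl | rfl <;> rcases hyb with rfl | rfl <;> simp_all
  have hac : a ≠ c := by
    rintro rfl
    rcases hxa with rfl | rfl <;> rcases hzc with rfl | rfl <;> simp_all
  have hbc : b ≠ c := by
    rintro rfl
    rcases hyb with rfl | rfl <;> rcases hzc with rfl | rfl <;> simp_all
  have hT : ({a, b, c} : Finset G) ⊆ Q := by
    intro t ht
    simp only [Finset.mem_insert, Finset.mem_singleton] at ht
    rcases ht with rfl | rfl | rfl <;> assumption
  have hTc : ({a, b, c} : Finset G).card = 3 := Finset.card_eq_three.2 ⟨a, b, c, hab, hac, hbc, rfl⟩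
  obtain ⟨d, hdQ, hdT⟩ : ∃ d ∈ Q, d ∉ ({a, b, c} : Finset G) := by
    by_contra! h
    have := Finset.card_le_card (show Q ⊆ {a, b, c} from h)
    omega
  have hQeq : insert d ({a, b, c} : Finset G) = Q :=
    Finset.eq_of_subset_of_card_le (Finset.insert_subset hdQ hT)
      (by rw [Finset.card_insert_of_notMem hdT, hTc, h4])
  have e0 : IsSumDiff (∅ : Finset G) 0 := ⟨0, by simp, by simp⟩
  have e1 := ((e0.insert (q := c) (by simp) hzc).insert (q := b) (by simpa using hbc) hyb).insert
    (q := a) (by simp [hab, hac]) hxa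
  rw [insert_empty_eq] at e1
  have e2 := e1.two_le_diffRep hdT (hQ.ne_zero hdQ)
  rw [hQeq, show 0 + z + y + x = x + y + z by abel] at e2
  have := card_le_popular (B := Q.subsetSum) (t := 1)
    (X := insert (x + y + z) (symHull Q + symHull Q))
    (by
      intro u hu
      rcases Finset.mem_insert.1 hu with rfl | hu
      · exact e2
      · exact hr u hu)
  rw [Finset.card_insert_of_notMem hw] at this
  omega

/-- A zero-sum free set of four elements with only ten subset sums is extended by at least six
new sums when a fifth element is adjoined. -/
lemma ZeroSumFree.card_insert_of_card_eq_ten (hodd : Odd (Nat.card G)) {Q : Finset G} {x : G}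
    (hx : x ∉ Q) (hS : ZeroSumFree (insert x Q)) (h4 : Q.card = 4)
    (hN : 21 ≤ Nat.card (AddSubgroup.closure (Q : Set G))) (h10 : Q.subsetSum.card = 10) :
    16 ≤ (insert x Q).subsetSum.card := by
  by_contra! hlt
  have hQ : ZeroSumFree Q := hS.mono (Finset.subset_insert _ _)
  -- At most 15 sums after insertion means that at least `2 * 10 - 15` overlap.
  have hx5 : 5 ≤ diffRep Q.subsetSum x := by
    have := card_subsetSum_insert hx
    omega
  have h7 : ∀ y ∈ Q, 7 ≤ (Q.erase y).subsetSum.card := fun y hy =>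
    (hQ.mono (Finset.erase_subset y Q)).card_three hodd (by rw [Finset.card_erase_of_mem hy, h4])
  have hr := le_diffRep_symHull_of_erase (Finset.card_pos.1 (by omega)) h7
  obtain ⟨q, hq, hq8⟩ := hQ.exists_card_erase_ge hodd h4
  have hr8 := hq8.trans (card_erase_le_diffRep hq)
  have c1 := card_symHull hodd hQ
  have c2 := card_double_symHull_ge hodd hQ (n := 15) (by omega) (Or.inl ⟨h4, le_rfl⟩)
  have c3 := card_triple_symHull_ge hodd hQ hN (Or.inl ⟨h4, le_rfl⟩)
  have c5 := card_symHull hodd hS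
  have cq := card_symHull hodd (hQ.mono (Finset.singleton_subset_iff.2 hq))
  rw [h4] at c1
  rw [Finset.card_insert_of_notMem hx, h4] at c5
  rw [Finset.card_singleton] at cq
  have hr5 : ∀ y ∈ symHull (insert x Q), 5 ≤ diffRep Q.subsetSum y := by
    refine le_diffRep_symHull (by omega) fun y hy => ?_
    rcases Finset.mem_insert.1 hy with rfl | hy
    · exact hx5
    · exact (by norm_num : 5 ≤ 7).trans (hr y (mem_symHull.2 (Or.inr (Or.inl hy))))
  have hrq : ∀ y ∈ symHull {q}, 8 ≤ diffRep Q.subsetSum y :=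
    le_diffRep_symHull (by omega) (by simpa using hr8)
  have p0 := card_triple_le_popular (t := 0) hr (by omega)
  have p1 := hQ.sixteen_le_popular hodd h4 hN fun y hy => by
    obtain ⟨u, hu, v, hv, rfl⟩ := Finset.mem_add.1 hy
    have := diffRep_add Q.subsetSum u v
    have := hr u hu
    have := hr v hv
    omega
  have p2 := card_double_le_popular (t := 2) hr (by omega)
  have p3 := card_double_le_popular (t := 3) hr (by omega)
  have p4 := card_le_popular (t := 4) fun y hy => hr5 y hy
  have p5 := card_le_popular (t := 5) fun y hy => (by norm_num : 5 < 7).trans_le (hr y hy)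
  have p6 := card_le_popular (t := 6) fun y hy => hr y hy
  have p7 := card_le_popular (t := 7) fun y hy => hrq y hy
  have p8 := one_le_popular (B := Q.subsetSum) (t := 8) (by omega)
  have p9 := one_le_popular (B := Q.subsetSum) (t := 9) (by omega)
  -- The layers add up to at least 21 + 16 + 15 + 15 + 11 + 9 + 9 + 3 + 1 + 1 = 101, just above 10².
  -- Hence the extra element in `p1` and the special `q` in `p7`.
  have hsum := sum_card_popular Q.subsetSum
  rw [h10] at hsum
  simp only [Finset.sum_range_succ, Finset.sum_range_zero] at hsum
  omega

-- The old sums and their translates by `x` lie in different cosets of the closure of `S`.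
omit [Fintype G] in
lemma card_subsetSum_insert_of_notMem_closure {S : Finset G} {x : G}
    (hx : x ∉ AddSubgroup.closure (S : Set G)) :
    (insert x S).subsetSum.card = 2 * S.subsetSum.card := by
  have hxS : x ∉ S := fun h => hx (AddSubgroup.subset_closure h)
  rw [← card_subsetSum_insert hxS]
  suffices diffRep S.subsetSum x = 0 by omega
  refine Finset.card_eq_zero.2 (Finset.eq_empty_of_forall_notMem fun u hu => ?_)
  rw [Finset.mem_filter] at hu
  have h := subsetSum_subset_of_subset (H := AddSubgroup.closure (S : Set G))
    fun y hy => AddSubgroup.subset_closure hy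
  exact hx (by simpa using AddSubgroup.sub_mem _ (h _ hu.2) (h _ hu.1))

omit [Fintype G] in
lemma closure_insert_of_mem {S : Finset G} {x : G}
    (hx : x ∈ AddSubgroup.closure (S : Set G)) :
    AddSubgroup.closure ((insert x S : Finset G) : Set G) = AddSubgroup.closure (S : Set G) := by
  refine le_antisymm ((AddSubgroup.closure_le _).2 fun y hy => ?_)
    (AddSubgroup.closure_mono (by simp))
  rw [Finset.coe_insert] at hy
  rcases hy with rfl | hy
  · exact hx
  · exact AddSubgroup.subset_closure hy

variable [IsAddCyclic G]

lemma ZeroSumFree.nine_le_card_four (hodd : Odd (Nat.card G)) {S : Finset G} (hS : ZeroSumFree S)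
    (h4 : S.card = 4) : 10 ≤ S.subsetSum.card ∨
      9 ≤ S.subsetSum.card ∧ Nat.card (AddSubgroup.closure (S : Set G)) = 9 := by
  rcases le_or_gt 15 (Nat.card (AddSubgroup.closure (S : Set G))) with h | h
  · exact Or.inl (hS.card_four hodd h4 h)
  · exact hS.card_four_of_small hodd h4 (by omega)

/-- If deleting `x` left at most ten sums, restoring it would give at least 16 when `x` lies in the
subgroup generated by the rest, and at least 18 by doubling otherwise. -/
lemma ZeroSumFree.eleven_le_card_erase (hodd : Odd (Nat.card G)) {S : Finset G}
    (hS : ZeroSumFree S) (h5 : S.card = 5)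
    (hN : 21 ≤ Nat.card (AddSubgroup.closure (S : Set G))) (h15 : S.subsetSum.card ≤ 15) :
    ∀ x ∈ S, 11 ≤ (S.erase x).subsetSum.card := by
  intro x hx
  by_contra! hlt
  have hxQ := Finset.notMem_erase x S
  have hins := Finset.insert_erase hx
  have h4 : (S.erase x).card = 4 := by rw [Finset.card_erase_of_mem hx, h5]
  set Q := S.erase x
  rw [← hins] at hS hN h15
  have h9 := (hS.mono (Finset.subset_insert x Q)).nine_le_card_four hodd h4
  by_cases hcl : x ∈ AddSubgroup.closure (Q : Set G)
  · rw [closure_insert_of_mem hcl] at hN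
    have := hS.card_insert_of_card_eq_ten hodd hxQ h4 hN (by omega)
    omega
  · have := card_subsetSum_insert_of_notMem_closure hcl
    omega

lemma ZeroSumFree.card_five (hodd : Odd (Nat.card G)) {S : Finset G} (hS : ZeroSumFree S)
    (h5 : S.card = 5) : 15 ≤ S.subsetSum.card := by
  rcases le_or_gt (Nat.card (AddSubgroup.closure (S : Set G))) 20 with hN | hN
  · exact hS.card_five_of_small hodd h5 hN
  by_contra! hlt
  have hr := le_diffRep_symHull_of_erase (Finset.card_pos.1 (by omega))
    (hS.eleven_le_card_erase hodd h5 hN (by omega))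
  have hge : 11 ≤ S.subsetSum.card := by
    simpa [diffRep_zero] using hr 0 (zero_mem_symHull S)
  have c1 := card_symHull hodd hS
  rw [h5] at c1
  have c2 := card_double_symHull_ge hodd hS hN (Or.inr (Or.inl ⟨h5, le_rfl⟩))
  have hsum := sum_card_popular S.subsetSum
  have p1 : ∀ t, t < S.subsetSum.card → 1 ≤ (popular S.subsetSum t).card :=
    fun t ht => one_le_popular ht
  have p2 : ∀ t, t < 11 → 11 ≤ (popular S.subsetSum t).card :=
    fun t ht => c1.ge.trans <| card_le_popular fun x hx => ht.trans_le (hr x hx)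
  have p3 : ∀ t, t + S.subsetSum.card < 22 → 21 ≤ (popular S.subsetSum t).card :=
    fun t ht => c2.trans (card_double_le_popular hr ht)
  generalize hb : S.subsetSum.card = b at *
  -- The threshold 22 is twice the deletion bound 11.
  have hb' : ∑ t ∈ Finset.range b,
      (if t + b < 22 then 21 else if t < 11 then 11 else 1) ≤ b ^ 2 := by
    rw [← hsum]
    refine Finset.sum_le_sum fun t ht => ?_
    have := Finset.mem_range.1 ht
    split_ifs with h1 h2
    · exact p3 t h1
    · exact p2 t h2
    · exact p1 t this
  interval_cases b <;> revert hb' <;> decide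

lemma ZeroSumFree.card_insert_of_card_eq_fifteen (hodd : Odd (Nat.card G)) {S : Finset G} {z : G}
    (hz : z ∉ S) (hS : ZeroSumFree (insert z S)) (h5 : S.card = 5)
    (hN : 31 ≤ Nat.card (AddSubgroup.closure (S : Set G))) (h15 : S.subsetSum.card = 15) :
    21 ≤ (insert z S).subsetSum.card := by
  by_contra! hlt
  have hS' : ZeroSumFree S := hS.mono (Finset.subset_insert _ _)
  have hz10 : 10 ≤ diffRep S.subsetSum z := by
    have := card_subsetSum_insert hz
    omega
  have hr := le_diffRep_symHull_of_erase (Finset.card_pos.1 (by omega))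
    (hS'.eleven_le_card_erase hodd h5 (by omega) (by omega))
  have c1 := card_symHull hodd hS'
  have c2 := card_double_symHull_ge hodd hS' (n := 21) (by omega) (Or.inr (Or.inl ⟨h5, le_rfl⟩))
  have c3 := card_triple_symHull_ge hodd hS' hN (Or.inr (Or.inl ⟨h5, le_rfl⟩))
  have c6 := card_symHull hodd hS
  rw [h5] at c1
  rw [Finset.card_insert_of_notMem hz, h5] at c6
  have hr10 : ∀ y ∈ symHull (insert z S), 10 ≤ diffRep S.subsetSum y := by
    refine le_diffRep_symHull (by omega) fun y hy => ?_
    rcases Finset.mem_insert.1 hy with rfl | hy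
    · exact hz10
    · exact (by norm_num : 10 ≤ 11).trans (hr y (mem_symHull.2 (Or.inr (Or.inl hy))))
  have hsum := sum_card_popular S.subsetSum
  -- The thresholds are 3 = 3·11 - 2·15, 7 = 2·11 - 15, 10 from `hz10`, and 11. The lower bounds
  -- total 231, against 225.
  have hb' : ∑ t ∈ Finset.range 15, (if t < 3 then 31 else if t < 7 then 21 else if t < 10 then 13
      else if t < 11 then 11 else 1) ≤ 15 ^ 2 := by
    rw [← h15, ← hsum]
    refine Finset.sum_le_sum fun t ht => ?_
    have := Finset.mem_range.1 ht
    split_ifs with h1 h2 h3 h4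
    · exact c3.trans (card_triple_le_popular hr (by omega))
    · exact c2.trans (card_double_le_popular hr (by omega))
    · exact c6.ge.trans (card_le_popular fun x hx => h3.trans_le (hr10 x hx))
    · exact c1.ge.trans (card_le_popular fun x hx => h4.trans_le (hr x hx))
    · exact one_le_popular this
  revert hb'
  decide

lemma ZeroSumFree.card_six (hodd : Odd (Nat.card G)) {S : Finset G} (hS : ZeroSumFree S)
    (h6 : S.card = 6) : 21 ≤ S.subsetSum.card := by
  rcases le_or_gt (Nat.card (AddSubgroup.closure (S : Set G))) 30 with hN | hN
  · exact hS.card_six_of_small hodd h6 hN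
  by_contra! hlt
  -- A five-element subset with exactly 15 sums would already force 21 sums on `S`, by the layer
  -- count or by doubling.
  have h16 : ∀ x ∈ S, 16 ≤ (S.erase x).subsetSum.card := by
    intro x hx
    have hxQ := Finset.notMem_erase x S
    have hins := Finset.insert_erase hx
    have h5 : (S.erase x).card = 5 := by rw [Finset.card_erase_of_mem hx, h6]
    set Q := S.erase x
    rw [← hins] at hS hN hlt
    have h15 := (hS.mono (Finset.subset_insert x Q)).card_five hodd h5
    by_contra! hlt'
    by_cases hcl : x ∈ AddSubgroup.closure (Q : Set G)
    · rw [closure_insert_of_mem hcl] at hN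
      have := hS.card_insert_of_card_eq_fifteen hodd hxQ h5 hN (by omega)
      omega
    · have := card_subsetSum_insert_of_notMem_closure hcl
      omega
  have hr := le_diffRep_symHull_of_erase (Finset.card_pos.1 (by omega)) h16
  have hge : 16 ≤ S.subsetSum.card := by
    simpa [diffRep_zero] using hr 0 (zero_mem_symHull S)
  have c1 := card_symHull hodd hS
  rw [h6] at c1
  have c2 := card_double_symHull_ge hodd hS (n := 25) (by omega) (Or.inr (Or.inr ⟨h6, le_rfl⟩))
  have c3 := card_triple_symHull_ge hodd hS hN (Or.inr (Or.inr ⟨h6, le_rfl⟩))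
  have hsum := sum_card_popular S.subsetSum
  have p1 : ∀ t, t < S.subsetSum.card → 1 ≤ (popular S.subsetSum t).card :=
    fun t ht => one_le_popular ht
  have p2 : ∀ t, t < 16 → 13 ≤ (popular S.subsetSum t).card :=
    fun t ht => c1.ge.trans <| card_le_popular fun x hx => ht.trans_le (hr x hx)
  have p3 : ∀ t, t + S.subsetSum.card < 32 → 25 ≤ (popular S.subsetSum t).card :=
    fun t ht => c2.trans (card_double_le_popular hr ht)
  have p4 : ∀ t, t + 2 * S.subsetSum.card < 48 → 31 ≤ (popular S.subsetSum t).card :=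
    fun t ht => c3.trans (card_triple_le_popular hr ht)
  generalize hb : S.subsetSum.card = b at *
  -- Triple sums have at least `48 - 2 * b` representations and double sums at least `32 - b`. The
  -- case `b = 20` is tight: 404 against 400.
  have hb' : ∑ t ∈ Finset.range b, (if t + 2 * b < 48 then 31 else if t + b < 32 then 25
      else if t < 16 then 13 else 1) ≤ b ^ 2 := by
    rw [← hsum]
    refine Finset.sum_le_sum fun t ht => ?_
    have := Finset.mem_range.1 ht
    split_ifs with h1 h2 h3
    · exact p4 t h1
    · exact p3 t h2
    · exact p2 t h3
    · exact p1 t this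
  interval_cases b <;> revert hb' <;> decide

end FiveAndSix

/-! ### From sets to sequences -/

section Sequences

variable {G : Type*} [AddCommGroup G] [DecidableEq G]

/-- The set of all sums of (possibly empty) subsequences of `S`. -/
def subseqSums (S : Multiset G) : Finset G := (S.powerset.map Multiset.sum).toFinset

lemma mem_subseqSums {S : Multiset G} {g : G} : g ∈ subseqSums S ↔ ∃ T ≤ S, T.sum = g := by
  simp [subseqSums]

lemma zero_mem_subseqSums (S : Multiset G) : 0 ∈ subseqSums S :=
  mem_subseqSums.2 ⟨0, Multiset.zero_le S, Multiset.sum_zero⟩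

lemma subseqSums_add (S T : Multiset G) : subseqSums (S + T) = subseqSums S + subseqSums T := by
  ext g
  simp only [Finset.mem_add, mem_subseqSums]
  constructor
  · rintro ⟨U, hU, rfl⟩
    refine ⟨_, ⟨U ∩ S, Multiset.inter_le_right, rfl⟩, _, ⟨U - S, ?_, rfl⟩, ?_⟩
    · rwa [tsub_le_iff_left]
    · rw [← Multiset.sum_add, add_comm, Multiset.sub_add_inter]
  · rintro ⟨_, ⟨U, hU, rfl⟩, _, ⟨V, hV, rfl⟩, rfl⟩
    exact ⟨U + V, add_le_add hU hV, Multiset.sum_add U V⟩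

lemma subseqSums_val (S : Finset G) : subseqSums S.val = S.subsetSum := by
  ext g
  rw [mem_subseqSums, Finset.mem_subsetSum_iff]
  constructor
  · rintro ⟨T, hT, rfl⟩
    exact ⟨⟨T, Multiset.nodup_of_le hT S.nodup⟩, Finset.val_le_iff.1 hT, by
      rw [Finset.sum_eq_multiset_sum, Multiset.map_id']⟩
  · rintro ⟨T, hT, rfl⟩
    exact ⟨T.val, Finset.val_le_iff.2 hT, by
      rw [Finset.sum_eq_multiset_sum, Multiset.map_id']⟩

omit [DecidableEq G] in
lemma SeqZeroSumFree.eq_zero {S T : Multiset G} (hS : SeqZeroSumFree S) (hT : T ≤ S)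
    (h : T.sum = 0) : T = 0 := by
  by_contra hne
  exact hS ⟨T, hT, Multiset.card_pos.2 hne, h⟩

omit [DecidableEq G] in
lemma SeqZeroSumFree.mono {S T : Multiset G} (hS : SeqZeroSumFree S) (h : T ≤ S) :
    SeqZeroSumFree T := by
  rintro ⟨U, hU, h1, h2⟩
  exact hS ⟨U, hU.trans h, h1, h2⟩

omit [DecidableEq G] in
lemma SeqZeroSumFree.zeroSumFree {S : Multiset G} {T : Finset G} (hS : SeqZeroSumFree S)
    (h : T.val ≤ S) : ZeroSumFree T := by
  intro U hU hne hsum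
  have := hS.eq_zero ((Finset.val_le_iff.2 hU).trans h)
    (by rwa [Finset.sum_eq_multiset_sum, Multiset.map_id'] at hsum)
  rw [Finset.val_eq_zero] at this
  exact hne.ne_empty this

variable [Fintype G]

/-- Subsequences of `S` and of `T` whose sums cancel form a zero-sum subsequence of `S + T`, so both
are empty and 0 is uniquely represented. -/
lemma card_subseqSums_add {S T : Multiset G} (h : SeqZeroSumFree (S + T)) :
    (subseqSums S).card + (subseqSums T).card ≤ (subseqSums (S + T)).card + 1 := by
  rw [subseqSums_add]
  refine card_add_card_le_of_unique_zero (zero_mem_subseqSums S) (zero_mem_subseqSums T) ?_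
  intro a ha b hb hab
  obtain ⟨U, hU, rfl⟩ := mem_subseqSums.1 ha
  obtain ⟨V, hV, rfl⟩ := mem_subseqSums.1 hb
  have := h.eq_zero (add_le_add hU hV) (by rw [Multiset.sum_add, hab])
  rw [(add_eq_zero.1 this).2, Multiset.sum_zero]

lemma card_subseqSums_sub {S : Multiset G} {T : Finset G} (hS : SeqZeroSumFree S)
    (hT : T.val ≤ S) :
    (subseqSums (S - T.val)).card + T.subsetSum.card ≤ (subseqSums S).card + 1 := by
  have h := Multiset.sub_add_cancel hT
  rw [← subseqSums_val]
  conv_rhs => rw [← h]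
  exact card_subseqSums_add (by rwa [h])

variable [IsAddCyclic G]

/-- The bound is the line through (5, 15) and (6, 21). At four elements it asks only for nine sums,
so the exceptional case is harmless here. -/
lemma ZeroSumFree.six_mul_card_le (hodd : Odd (Nat.card G)) {T : Finset G} (hT : ZeroSumFree T)
    (h6 : T.card ≤ 6) : 6 * T.card + 1 ≤ T.subsetSum.card + 16 := by
  obtain h | h | h | h | h : T.card ≤ 2 ∨ T.card = 3 ∨ T.card = 4 ∨ T.card = 5 ∨
    T.card = 6 := by omega
  · omega
  · have := hT.card_three hodd h
    omega
  · have := hT.nine_le_card_four hodd h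
    omega
  · have := hT.card_five hodd h
    omega
  · have := hT.card_six hodd h
    omega

/-- Peel off one set of at most six distinct elements for each unit of `h`; each costs 16 in the
estimate. -/
lemma le_card_subseqSums (hodd : Odd (Nat.card G)) (h : ℕ) : ∀ S : Multiset G, SeqZeroSumFree S →
    (∀ g, S.count g ≤ h) → S.card ≤ 6 * h → 6 * S.card + 1 ≤ (subseqSums S).card + 16 * h := by
  induction h with
  | zero =>
    intro S _ _ hcard
    have : 0 < (subseqSums S).card := Finset.card_pos.2 ⟨0, zero_mem_subseqSums S⟩
    omega
  | succ h ih =>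
    intro S hS hcount hcard
    -- `T` must contain every element of multiplicity `h + 1`; the length bound allows at most six
    -- of these. With fewer than six distinct elements the whole support is removed, and the
    -- multiplicities bound what remains.
    have key : ∃ T ⊆ S.toFinset, T.card ≤ 6 ∧ (∀ g, S.count g = h + 1 → g ∈ T) ∧
        (S - T.val).card ≤ 6 * h := by
      have hsum : ∑ g ∈ S.toFinset, S.count g = S.card := Multiset.toFinset_sum_count_eq S
      rcases le_or_gt 6 S.toFinset.card with h6 | h6
      · set U := S.toFinset.filter fun g => S.count g = h + 1 with hU
        have hU6 : U.card ≤ 6 := by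
          have h1 : U.card * (h + 1) ≤ S.card := by
            rw [← hsum, ← smul_eq_mul, ← Finset.sum_const]
            refine le_trans (Finset.sum_le_sum fun g hg => (Finset.mem_filter.1 hg).2.ge)
              (Finset.sum_le_sum_of_subset (Finset.filter_subset _ _))
          exact Nat.le_of_mul_le_mul_right (h1.trans hcard) (Nat.succ_pos h)
        obtain ⟨T, hUT, hTS, hT6⟩ :=
          Finset.exists_subsuperset_card_eq (Finset.filter_subset _ S.toFinset) hU6 h6
        refine ⟨T, hTS, hT6.le, fun g hg => hUT (Finset.mem_filter.2 ⟨?_, hg⟩), ?_⟩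
        · rw [Multiset.mem_toFinset, ← Multiset.count_pos]
          omega
        · rw [Multiset.card_sub (Multiset.le_iff_subset T.nodup |>.2 fun x hx =>
            Multiset.mem_toFinset.1 (hTS hx)), Finset.card_val, hT6]
          omega
      · refine ⟨S.toFinset, subset_rfl, h6.le, fun g hg => ?_, ?_⟩
        · rw [Multiset.mem_toFinset, ← Multiset.count_pos]
          omega
        · rw [← Multiset.sum_count_eq_card (s := S.toFinset) (m := S - S.toFinset.val)
            (fun a ha => Multiset.mem_toFinset.2 (Multiset.mem_of_le (Multiset.sub_le_self _ _) ha))]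
          refine (Finset.sum_le_card_nsmul _ _ h fun g hg => ?_).trans ?_
          · have h1 : 1 ≤ S.toFinset.val.count g := Multiset.one_le_count_iff_mem.2 hg
            have := hcount g
            rw [Multiset.count_sub]
            omega
          · rw [smul_eq_mul]
            exact Nat.mul_le_mul_right h h6.le
    obtain ⟨T, hTS, hT6, hTmax, hTcard⟩ := key
    have hTle : T.val ≤ S := (Multiset.le_iff_subset T.nodup).2 fun x hx =>
      Multiset.mem_toFinset.1 (hTS hx)
    have h1 := ih (S - T.val) (hS.mono (Multiset.sub_le_self _ _)) (fun g => by
      rw [Multiset.count_sub]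
      have := hcount g
      by_cases hg : S.count g = h + 1
      · have h1 : 1 ≤ T.val.count g := Multiset.one_le_count_iff_mem.2 (hTmax g hg)
        omega
      · omega) hTcard
    have h2 := card_subseqSums_sub hS hTle
    have h3 := (hS.zeroSumFree hTle).six_mul_card_le hodd hT6
    have h4 := Multiset.card_le_card hTle
    rw [Multiset.card_sub hTle, Finset.card_val] at h1
    rw [Finset.card_val] at h4
    omega

/-- A zero-sum free set of five elements contains four elements with at least ten subset sums. -/
lemma ZeroSumFree.exists_ten_le_card (hodd : Odd (Nat.card G)) {U : Finset G} (hU : ZeroSumFree U)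
    (h5 : U.card = 5) : ∃ T ⊆ U, T.card = 4 ∧ 10 ≤ T.subsetSum.card := by
  by_contra! hlt
  -- If every four-element subset is exceptional, then each `u` lies in a group of order 9. The
  -- cyclic group `G` has at most nine elements killed by 9, too few for the 15 sums of `U`.
  have h9 : ∀ u ∈ U, 9 • u = 0 := by
    intro u hu
    obtain ⟨y, hy, hyu⟩ := Finset.exists_mem_ne (s := U) (by omega) u
    have hsub := Finset.erase_subset y U
    have h4 : (U.erase y).card = 4 := by rw [Finset.card_erase_of_mem hy, h5]
    have hcard : Nat.card (AddSubgroup.closure ((U.erase y : Finset G) : Set G)) = 9 := by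
      rcases (hU.mono hsub).nine_le_card_four hodd h4 with h | h
      · exact absurd h (hlt _ hsub h4).not_ge
      · exact h.2
    have hmem : u ∈ AddSubgroup.closure ((U.erase y : Finset G) : Set G) :=
      AddSubgroup.subset_closure (Finset.mem_erase.2 ⟨hyu.symm, hu⟩)
    have : Nat.card (AddSubgroup.closure ((U.erase y : Finset G) : Set G)) •
      (⟨u, hmem⟩ : AddSubgroup.closure ((U.erase y : Finset G) : Set G)) = 0 := card_nsmul_eq_zero'
    rw [hcard] at this
    exact congrArg Subtype.val this
  have h15 := hU.card_five hodd h5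
  have hle : U.subsetSum.card ≤ (Finset.univ.filter fun g : G => 9 • g = 0).card := by
    refine Finset.card_le_card fun w hw => ?_
    obtain ⟨T, hT, rfl⟩ := Finset.mem_subsetSum_iff.1 hw
    rw [Finset.mem_filter, Finset.smul_sum]
    exact ⟨Finset.mem_univ _, Finset.sum_eq_zero fun x hx => h9 x (hT hx)⟩
  have := IsAddCyclic.card_nsmul_eq_zero_le (α := G) (n := 9) (by norm_num)
  omega

end Sequences

/-! ### The final count -/

theorem corollary4p3 {G : Type*} [AddCommGroup G] [Finite G] [IsAddCyclic G] [DecidableEq G]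
    (hodd : Odd (Nat.card G)) (S : Multiset G) (hS : SeqZeroSumFree S)
    (hlen : (6 * (Nat.card G : ℝ) + 26) / 20 ≤ (S.card : ℝ)) :
    ∃ g : G, g ∈ S ∧
      (6 * (S.card : ℝ) - (Nat.card G : ℝ) + 1) / 16 ≤ (S.count g : ℝ) := by
  have := Fintype.ofFinite G
  by_contra! hcon
  set n := Nat.card G with hn
  set s := S.card with hs
  have hlen' : 6 * n + 26 ≤ 20 * s := by
    rw [div_le_iff₀ (by norm_num)] at hlen
    have : (6 * n + 26 : ℝ) ≤ 20 * s := by linarith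
    exact_mod_cast this
  set h := (6 * s - n) / 16 with hh
  have hcount : ∀ g, S.count g ≤ h := by
    intro g
    by_cases hg : g ∈ S
    · have h1 := hcon g hg
      rw [lt_div_iff₀ (by norm_num)] at h1
      have h2 : (S.count g * 16 + n : ℝ) < 6 * s + 1 := by linarith
      have h3 : S.count g * 16 + n < 6 * s + 1 := by exact_mod_cast h2
      omega
    · rw [Multiset.count_eq_zero_of_notMem hg]
      exact Nat.zero_le h
  have hle : (subseqSums S).card ≤ n := by
    rw [hn, Nat.card_eq_fintype_card]
    exact Finset.card_le_univ _
  rcases le_or_gt s (6 * h) with hsh | hsh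
  · have := le_card_subseqSums hodd h S hS hcount hsh
    omega
  -- Six elements of multiplicity at most `h` give length at most `6 * h`. Five distinct elements
  -- suffice below.
  have h7 : 7 ≤ S.toFinset.card := by
    by_contra! h6
    have h1 := Finset.sum_le_card_nsmul S.toFinset (fun g => S.count g) h fun g _ => hcount g
    rw [Multiset.toFinset_sum_count_eq, smul_eq_mul] at h1
    have := Nat.mul_le_mul_right h (show S.toFinset.card ≤ 6 by omega)
    omega
  have hsub : ∀ T : Finset G, T ⊆ S.toFinset → T.val ≤ S := fun T hT =>
    (Multiset.le_iff_subset T.nodup).2 fun x hx => Multiset.mem_toFinset.1 (hT hx)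
  -- The `6 * h` terms left after removing `T` have at least 36h + 1 - 16h = 20h + 1 sums.
  have hrest : ∀ T : Finset G, T ⊆ S.toFinset → T.card = s - 6 * h →
      20 * h + T.subsetSum.card ≤ n := by
    intro T hT hTc
    have hTle := hsub T hT
    have hc : (S - T.val).card = 6 * h := by
      rw [Multiset.card_sub hTle, Finset.card_val, hTc]
      omega
    have h1 := le_card_subseqSums hodd h (S - T.val) (hS.mono (Multiset.sub_le_self _ _))
      (fun g => (Multiset.count_le_of_le g (Multiset.sub_le_self _ _)).trans (hcount g)) hc.le
    have h2 := card_subseqSums_sub hS hTle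
    omega
  -- The length hypothesis and the rounding in `h` give `s ≤ 6 * h + 4`. For remainders 1 to 4 the
  -- hypothesis bounds `n` by 20h - 1, 20h + 2, 20h + 5 and 20h + 9, so the last case needs ten
  -- sums.
  have hr : s - 6 * h = 1 ∨ s - 6 * h = 2 ∨ s - 6 * h = 3 ∨ s - 6 * h = 4 := by omega
  rcases hr with hr | hr | hr | hr
  · obtain ⟨T, hT, hTc⟩ := Finset.exists_subset_card_eq (show 1 ≤ S.toFinset.card by omega)
    have := hrest T hT (hTc.trans hr.symm)
    omega
  · obtain ⟨T, hT, hTc⟩ := Finset.exists_subset_card_eq (show 2 ≤ S.toFinset.card by omega)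
    have := hrest T hT (hTc.trans hr.symm)
    have := (hS.zeroSumFree (hsub T hT)).card_two hTc
    omega
  · obtain ⟨T, hT, hTc⟩ := Finset.exists_subset_card_eq (show 3 ≤ S.toFinset.card by omega)
    have := hrest T hT (hTc.trans hr.symm)
    have := (hS.zeroSumFree (hsub T hT)).card_three hodd hTc
    omega
  · obtain ⟨U, hU, hUc⟩ := Finset.exists_subset_card_eq (show 5 ≤ S.toFinset.card by omega)
    obtain ⟨T, hTU, hTc, h10⟩ := (hS.zeroSumFree (hsub U hU)).exists_ten_le_card hodd hUc
    have := hrest T (hTU.trans hU) (hTc.trans hr.symm)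
    omega
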